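/- **Definitions.** Graphs are simple and undirected. For a finite connected graph $K$, $\mathrm{UST}(K)$ is the uniform measure on the spanning trees of $K$; the same definition is used for finite connected multigraphs. Let $G$ be a locally finite connected graph. An exhaustion of $G$ is a sequence of finite connected subgraphs $G_1\subseteq G_2\subseteq\cdots$ of $G$ with $\bigcup_n G_n=G$. The free spanning forest $\mathrm{FSF}(G)$ is the probability measure on subgraphs $F$ of $G$ (with vertex set $V(G)$) such that for every exhaustion $(G_n)$ of $G$ and every finite subgraph $H$ of $G$, the law of $\mathrm{UST}(G_n)\cap H$ converges to the law of $F\cap H$. If $G$ is infinite, the wired spanning forest $\mathrm{WSF}(G)$ is defined in the same way, using only exhaustions by induced subgraphs, and with $\mathrm{UST}(G_n)$ replaced by $\mathrm{UST}(\widehat{G_n})$, where $\widehat{G_n}$ is the multigraph obtained from $G$ by identifying all vertices outside $G_n$ to a single vertex. (These measures exist and are unique.) For a subgraph $F$ of $G$ with vertex set $V(G)$, the induced-component graph $\overline F$ is the graph with vertex set $V(G)$ in which an edge of $G$ is present if and only if both its endpoints lie in the same connected component of $F$. For a random subgraph $H$ of $G$, $\mathrm{FSF}(H)$ denotes the unconditional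 law of the random subgraph of $G$ obtained by first sampling $H$ and then, given $H$, sampling an $\mathrm{FSF}$ independently on each connected component of $H$ and taking the union. **Theorem 1.4.** Let $G$ be a locally finite, infinite, connected graph, and let $\mathfrak F_{\mathrm w}$ and $\mathfrak F_{\mathrm f}$ be random subgraphs of $G$ with laws $\mathrm{WSF}(G)$ and $\mathrm{FSF}(G)$ respectively. Then $$\mathrm{FSF}(\overline{\mathfrak F_{\mathrm w}})=\mathrm{WSF}(G)\qquad\text{and}\qquad \mathrm{FSF}(\overline{\mathfrak F_{\mathrm f}})=\mathrm{FSF}(G).$$ In particular, almost surely, for every connected component $C$ of $\overline{\mathfrak F_{\mathrm w}}$, a sample of $\mathrm{FSF}(C)$ is almost surely connected (that is, it consists of a single tree), and the same holds for every connected component $C$ of $\overline{\mathfrak F_{\mathrm f}}$. -/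

import Mathlib

open MeasureTheory ProbabilityTheory Filter Topology

/-! Random subgraphs of a graph on `V` (all of them having vertex set `V`) are random elements of
`SimpleGraph V`, with Mathlib's σ-algebra, the one generated by the events `{F | F.Adj x y}`. -/

namespace SpanningForest

universe u

variable {V : Type u}

/-- An exhaustion of `G`: an increasing sequence of finite connected subgraphs with union `G`. -/
structure IsExhaustion (G : SimpleGraph V) (K : ℕ → G.Subgraph) : Prop where
  finite : ∀ n, (K n).verts.Finite
  connected : ∀ n, (K n).Connected
  mono : Monotone K
  iSup_eq : ⨆ n, K n = ⊤

/-- The spanning trees of a subgraph `K` of `G`, each recorded by its set of edges, as a graph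
on `V`. -/
def spanningTrees {G : SimpleGraph V} (K : G.Subgraph) : Set (SimpleGraph V) :=
  {T | T ≤ K.spanningCoe ∧ (T.induce K.verts).IsTree}

/-- The uniform spanning tree `UST(K)` of a finite connected subgraph `K` of `G`. -/
noncomputable def ust {G : SimpleGraph V} (K : G.Subgraph) : Measure (SimpleGraph V) :=
  uniformOn (spanningTrees K)

open Classical in
/-- The map identifying all vertices outside `S` to the single vertex `none`. -/
noncomputable def collapse (S : Set V) (v : V) : Option S :=
  if h : v ∈ S then some ⟨v, h⟩ else none

/-- The spanning trees of the multigraph obtained from `G` by identifying all vertices outside `S`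
to a single vertex. The edges of this multigraph are the edges `e` of `G`, the endpoints of `e`
being the images of its endpoints in `G` under `collapse S`. A set of edges is a spanning tree
if it has no loops, no two parallel edges, and the resulting simple graph on all the vertices is
a tree. Each spanning tree is recorded by its set of edges, as a subgraph of `G`. -/
def wiredSpanningTrees (G : SimpleGraph V) (S : Set V) : Set (SimpleGraph V) :=
  {T | T ≤ G ∧ (∀ e ∈ T.edgeSet, ¬ (e.map (collapse S)).IsDiag) ∧
    Set.InjOn (Sym2.map (collapse S)) T.edgeSet ∧
    (SimpleGraph.fromEdgeSet (Sym2.map (collapse S) '' T.edgeSet)).IsTree}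

/-- The wired spanning forest of a finite connected subgraph of `G` with vertex set `S`: the
uniform spanning tree of `G` with all vertices outside `S` identified. -/
noncomputable def wiredUst (G : SimpleGraph V) (S : Set V) : Measure (SimpleGraph V) :=
  uniformOn (wiredSpanningTrees G S)

/-- `μ` is the free spanning forest `FSF(G)`: a probability measure on the subgraphs of `G` such
that, for every exhaustion `(K n)` of `G` and every finite subgraph `H` of `G`, the law of
`UST(K n) ∩ H` converges to the law of `F ∩ H`, where `F` has law `μ`. -/
structure IsFSF (G : SimpleGraph V) (μ : Measure (SimpleGraph V)) : Prop where
  isProbabilityMeasure : IsProbabilityMeasure μ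
  ae_le : ∀ᵐ F ∂μ, F ≤ G
  tendsto : ∀ K : ℕ → G.Subgraph, IsExhaustion G K →
    ∀ H : SimpleGraph V, H ≤ G → H.edgeSet.Finite → ∀ B : SimpleGraph V,
      Tendsto (fun n => ust (K n) {T | T ⊓ H = B}) atTop (𝓝 (μ {F | F ⊓ H = B}))

/-- `μ` is the wired spanning forest `WSF(G)`: a probability measure on the subgraphs of `G` such
that, for every exhaustion `(K n)` of `G` by induced subgraphs and every finite subgraph `H` of
`G`, the law of `WSF(K n) ∩ H` converges to the law of `F ∩ H`, where `F` has law `μ`. -/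
structure IsWSF (G : SimpleGraph V) (μ : Measure (SimpleGraph V)) : Prop where
  isProbabilityMeasure : IsProbabilityMeasure μ
  ae_le : ∀ᵐ F ∂μ, F ≤ G
  tendsto : ∀ K : ℕ → G.Subgraph, IsExhaustion G K → (∀ n, (K n).IsInduced) →
    ∀ H : SimpleGraph V, H ≤ G → H.edgeSet.Finite → ∀ B : SimpleGraph V,
      Tendsto (fun n => wiredUst G (K n).verts {T | T ⊓ H = B}) atTop (𝓝 (μ {F | F ⊓ H = B}))

open Classical in
/-- The free spanning forest `FSF(G)` (a point mass if there were no measure as in `IsFSF`). -/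
noncomputable def fsf (G : SimpleGraph V) : Measure (SimpleGraph V) :=
  if h : ∃ μ, IsFSF G μ then h.choose else Measure.dirac ⊥

open Classical in
/-- The wired spanning forest `WSF(G)` (a point mass if there were no measure as in `IsWSF`). -/
noncomputable def wsf (G : SimpleGraph V) : Measure (SimpleGraph V) :=
  if h : ∃ μ, IsWSF G μ then h.choose else Measure.dirac ⊥

instance isProbabilityMeasure_fsf (G : SimpleGraph V) : IsProbabilityMeasure (fsf G) := by
  unfold fsf
  split_ifs with h
  · exact h.choose_spec.isProbabilityMeasure
  · infer_instance

/-- The induced-component graph of a subgraph `F` of `G`: an edge of `G` belongs to it if and only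
if both its endpoints belong to the same component of `F`. -/
def inducedComponentGraph (G F : SimpleGraph V) : SimpleGraph V where
  Adj x y := G.Adj x y ∧ F.Reachable x y
  symm := ⟨fun _ _ h => ⟨h.1.symm, h.2.symm⟩⟩
  loopless := ⟨fun _ h => h.1.ne rfl⟩

/-- For a fixed graph `H`, the law of the union of independent free spanning forests, one on each
component of `H`. -/
noncomputable def fsfOnComponents (H : SimpleGraph V) : Measure (SimpleGraph V) :=
  (Measure.infinitePi fun C : H.ConnectedComponent => fsf C.toSimpleGraph).map
    fun T => ⨆ C, (T C).spanningCoe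

/-- For a random graph `H` with law `P`, the unconditional law `FSF(H)` of the random graph obtained
by first sampling `H` and then sampling a free spanning forest independently on each component
of `H`. -/
noncomputable def fsfOfRandom (P : Measure (SimpleGraph V)) : Measure (SimpleGraph V) :=
  P.bind fsfOnComponents

end SpanningForest

/-! Write `F` for the forest (free or wired) and `F̄` for its induced-component graph. Both uniform
spanning trees and their wired versions are uniform bases of a finite graph `A` with the components
of a graph `W` contracted. So both halves of the theorem are one statement about limits of such
uniform bases (`IsBasesLimit`).

Domination. By Rayleigh monotonicity (`rayleigh`) and contraction of one edge at a time
(`basesProb_union_le_mul`), the probability that a uniform base contains a set `s` of edges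
decreases when edges are added or contracted. Let an event depend only on the connectivity of the
base inside a finite window `Q`, and force the endpoints of each edge of `A ≤ Q` to be connected
there. Conditioning also on the edges outside `A`, the base inside `A` is a uniform base of a
contraction of `A`, so it contains `s` with probability at most that of a uniform maximal spanning
forest of `A` (`ncard_basesWith_le_mul`). In the limit, given `F̄ ⊓ Q = D`, the forest `F` contains
`s` with probability at most that of a uniform spanning forest of `D`
(`IsBasesLimit.measure_le_mul`). As `Q` grows, this bound is in turn at most the probability that
independent free spanning forests on the components of `F̄` contain `s`
(`windowProb_le_fsfOnComponents`).

Equality. This one-sided bound concerns only events of containing edges. To reach a full cylinder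
event `F ⊓ Q = B`, put `D = F̄ ⊓ Q` and consider `links B D`: minimal edge sets that contain `B`,
connect the endpoints of every edge of `D`, and meet `D` exactly in `B`. Since `F` connects whatever
`F̄` joins, `F ⊓ Q = B` forces some link into `F`. Conversely a forest below `F̄` contains at most
one link, and containing one forces its trace on `Q` to be `B`. Summing the domination over links
gives `P(F ⊓ Q = B) ≤ P(T ⊓ Q = B)` for the resampled forest `T`. Both sides sum to 1 over `B`, so
equality holds throughout: the laws agree, and almost surely `T` contains a link for every window,
hence connects each component of `F̄` (`IsBasesLimit.resample`). -/

namespace SpanningForest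

open scoped ENNReal

universe u

variable {V : Type u}

/-! ### Reachability and single edges -/

/-- The relation `A.Adj ≤ R.Reachable` says that `A` lies in the matroid closure of `R`. In this
form closure is used throughout, and this is its transitivity. -/
lemma reachable_of_adj_le {A R : SimpleGraph V} (h : A.Adj ≤ R.Reachable) {a b : V}
    (hab : A.Reachable a b) : R.Reachable a b := by
  rw [SimpleGraph.reachable_iff_reflTransGen] at hab
  induction hab with
  | refl => exact .rfl
  | tail _ hbc ih => exact ih.trans (h _ _ hbc)

lemma adj_sup_le {A B : SimpleGraph V} {r : V → V → Prop} (hA : A.Adj ≤ r) (hB : B.Adj ≤ r) :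
    (A ⊔ B).Adj ≤ r := by
  intro a b hab
  rcases hab with h | h
  exacts [hA _ _ h, hB _ _ h]

lemma edge_adj_le {u v : V} {R : SimpleGraph V} (h : R.Reachable u v) :
    (SimpleGraph.edge u v).Adj ≤ R.Reachable := by
  intro a b hab
  rw [SimpleGraph.edge_adj] at hab
  rcases hab.1 with ⟨rfl, rfl⟩ | ⟨rfl, rfl⟩
  exacts [h, h.symm]

lemma adj_le_reachable_of_le {A R : SimpleGraph V} (h : A ≤ R) : A.Adj ≤ R.Reachable :=
  fun _ _ hab => (h hab).reachable

/-- One crossing of the new edge suffices: along a walk, a second crossing either undoes or repeats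
the first, so the cases never multiply. -/
lemma reachable_sup_edge {Z : SimpleGraph V} {u v a b : V}
    (h : (Z ⊔ SimpleGraph.edge u v).Reachable a b) :
    Z.Reachable a b ∨ (Z.Reachable a u ∧ Z.Reachable v b) ∨
      (Z.Reachable a v ∧ Z.Reachable u b) := by
  rw [SimpleGraph.reachable_iff_reflTransGen] at h
  induction h with
  | refl => exact .inl .rfl
  | @tail b c _ hbc ih =>
    rw [SimpleGraph.sup_adj, SimpleGraph.edge_adj] at hbc
    rcases hbc with hbc | ⟨⟨rfl, rfl⟩ | ⟨rfl, rfl⟩, -⟩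
    · have := hbc.reachable
      rcases ih with h | h | h
      · exact .inl (h.trans this)
      · exact .inr (.inl ⟨h.1, h.2.trans this⟩)
      · exact .inr (.inr ⟨h.1, h.2.trans this⟩)
    · rcases ih with h | h | h
      · exact .inr (.inl ⟨h, .rfl⟩)
      · exact .inr (.inl ⟨h.1, .rfl⟩)
      · exact .inl h.1
    · rcases ih with h | h | h
      · exact .inr (.inr ⟨h, .rfl⟩)
      · exact .inl h.1
      · exact .inr (.inr ⟨h.1, .rfl⟩)

lemma sdiff_edge_sup_edge {X : SimpleGraph V} {u v : V} (h : X.Adj u v) :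
    X \ SimpleGraph.edge u v ⊔ SimpleGraph.edge u v = X := by
  rw [sdiff_sup_self]
  exact SimpleGraph.sup_edge_of_adj _ h

lemma sup_edge_sdiff_edge {X : SimpleGraph V} {u v : V} (h : ¬ X.Adj u v) :
    (X ⊔ SimpleGraph.edge u v) \ SimpleGraph.edge u v = X := by
  rw [sup_sdiff_right_self, SimpleGraph.sdiff_edge _ h]

/-! ### Bases of the graphic matroid of `A` with the components of `W` contracted -/

/-- The edges of `X` are independent after contracting the components of `W`. -/
def Indep (W X : SimpleGraph V) : Prop :=
  ∀ u v, X.Adj u v → ¬ (X \ SimpleGraph.edge u v ⊔ W).Reachable u v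

/-- The maximal spanning forests of the graph obtained from `A` by contracting the components
of `W`, as sets of edges of `A`. -/
def bases (W A : SimpleGraph V) : Set (SimpleGraph V) :=
  {X | X ≤ A ∧ A.Adj ≤ (X ⊔ W).Reachable ∧ Indep W X}

lemma Indep.mono {W W' X X' : SimpleGraph V} (h : Indep W X) (hX : X' ≤ X) (hW : W' ≤ W) :
    Indep W' X' := fun u v huv hr =>
  h u v (hX huv) (hr.mono (sup_le_sup (sdiff_le_sdiff_right hX) hW))

/-- Removing an edge of an independent set separates its endpoints: any two vertices connected
before and not after are on different sides. -/
lemma reachable_sdiff_edge {X W : SimpleGraph V} {x y a b : V} (hxy : X.Adj x y)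
    (h : (X ⊔ W).Reachable a b) :
    (X \ SimpleGraph.edge x y ⊔ W).Reachable a b ∨
    ((X \ SimpleGraph.edge x y ⊔ W).Reachable a x ∧
      (X \ SimpleGraph.edge x y ⊔ W).Reachable y b) ∨
    ((X \ SimpleGraph.edge x y ⊔ W).Reachable a y ∧
      (X \ SimpleGraph.edge x y ⊔ W).Reachable x b) := by
  apply reachable_sup_edge
  rwa [sup_right_comm, sdiff_edge_sup_edge hxy]

/-- Adding an edge outside the closure keeps independence. -/
lemma Indep.sup_edge {W X : SimpleGraph V} {u v : V} (h : Indep W X)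
    (huv : ¬ (X ⊔ W).Reachable u v) : Indep W (X ⊔ SimpleGraph.edge u v) := by
  intro a b hab hr
  have hne : ¬ X.Adj u v := fun h => huv (SimpleGraph.Adj.reachable (.inl h))
  by_cases hX : X.Adj a b
  · have h1 : ((X \ SimpleGraph.edge a b ⊔ W) ⊔ SimpleGraph.edge u v).Reachable a b := by
      refine hr.mono ?_
      rw [sup_sdiff, sup_right_comm]
      gcongr
      exact sdiff_le
    have hle : X \ SimpleGraph.edge a b ⊔ W ≤ X ⊔ W := by gcongr; exact sdiff_le
    have hab' : (X ⊔ W).Reachable a b := SimpleGraph.Adj.reachable (.inl hX)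
    rcases reachable_sup_edge h1 with h2 | h2 | h2
    · exact h a b hX h2
    · exact huv (((h2.1.mono hle).symm.trans hab').trans (h2.2.mono hle).symm)
    · exact huv (((h2.1.mono hle).symm.trans hab').trans (h2.2.mono hle).symm).symm
  · have he : (SimpleGraph.edge u v).Adj a b := hab.resolve_left hX
    have hE : SimpleGraph.edge a b = SimpleGraph.edge u v := by
      rw [SimpleGraph.edge_adj] at he
      rcases he.1 with ⟨rfl, rfl⟩ | ⟨rfl, rfl⟩
      · rfl
      · exact SimpleGraph.edge_comm _ _
    rw [hE, sup_edge_sdiff_edge hne] at hr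
    rw [SimpleGraph.edge_adj] at he
    rcases he.1 with ⟨rfl, rfl⟩ | ⟨rfl, rfl⟩
    exacts [huv hr, huv hr.symm]

lemma edgeSet_sup_edge_ncard {X : SimpleGraph V} {u v : V} (hX : X.edgeSet.Finite)
    (hne : u ≠ v) (h : ¬ X.Adj u v) :
    (X ⊔ SimpleGraph.edge u v).edgeSet.ncard = X.edgeSet.ncard + 1 := by
  rw [SimpleGraph.edgeSet_sup, SimpleGraph.edgeSet_edge_of_ne hne, Set.union_singleton,
    Set.ncard_insert_of_notMem (by simpa using h) hX]

lemma finite_edgeSet_of_le {X A : SimpleGraph V} (hA : A.edgeSet.Finite) (h : X ≤ A) :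
    X.edgeSet.Finite := hA.subset (SimpleGraph.edgeSet_mono h)

lemma edgeSet_sdiff_edge_ncard {X : SimpleGraph V} {u v : V} (hX : X.edgeSet.Finite)
    (h : X.Adj u v) : (X \ SimpleGraph.edge u v).edgeSet.ncard + 1 = X.edgeSet.ncard := by
  rw [← edgeSet_sup_edge_ncard (finite_edgeSet_of_le hX sdiff_le) h.ne
    (by simp [SimpleGraph.edge_adj, h.ne]), sdiff_edge_sup_edge h]

/-- Steinitz exchange: an independent set is no larger than a set spanning it. -/
lemma Indep.ncard_le {W I J : SimpleGraph V} (hI : Indep W I) (hIf : I.edgeSet.Finite)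
    (hJf : J.edgeSet.Finite) (h : I.Adj ≤ (J ⊔ W).Reachable) :
    I.edgeSet.ncard ≤ J.edgeSet.ncard := by
  induction hn : (I \ J).edgeSet.ncard using Nat.strong_induction_on generalizing I with
  | _ n ih =>
  by_cases hIJ : I ≤ J
  · exact Set.ncard_le_ncard (SimpleGraph.edgeSet_mono hIJ) hJf
  · obtain ⟨x, y, hxy, hxyJ⟩ : ∃ x y, I.Adj x y ∧ ¬ J.Adj x y := by
      by_contra! hcon
      exact hIJ fun {a b} hab => hcon a b hab
    set I' := I \ SimpleGraph.edge x y with hI'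
    -- Were `J` in the closure of `I` minus `xy`, then so would be `xy`, against independence. So
    -- some edge `uv` of `J` can replace `xy`, and the exchange decreases the number of edges in `I
    -- \ J`.
    have hnot : ¬ J.Adj ≤ (I' ⊔ W).Reachable := fun hJ =>
      hI x y hxy (reachable_of_adj_le (adj_sup_le hJ (adj_le_reachable_of_le le_sup_right))
        (h x y hxy))
    obtain ⟨u, v, huv, hr⟩ : ∃ u v, J.Adj u v ∧ ¬ (I' ⊔ W).Reachable u v := by
      by_contra! hcon
      exact hnot hcon
    have hI'n : ¬ I'.Adj u v := fun hh => hr (SimpleGraph.Adj.reachable (.inl hh))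
    have hind : Indep W (I' ⊔ SimpleGraph.edge u v) :=
      (hI.mono sdiff_le le_rfl).sup_edge hr
    have hfin : I'.edgeSet.Finite := finite_edgeSet_of_le hIf sdiff_le
    have hcard : (I' ⊔ SimpleGraph.edge u v).edgeSet.ncard = I.edgeSet.ncard := by
      rw [edgeSet_sup_edge_ncard hfin huv.ne hI'n, edgeSet_sdiff_edge_ncard hIf hxy]
    rw [← hcard]
    refine ih _ ?_ hind ?_ ?_ rfl
    · rw [← hn]
      refine Set.ncard_lt_ncard ?_ (finite_edgeSet_of_le hIf sdiff_le)
      refine ⟨SimpleGraph.edgeSet_mono ?_, fun hc => ?_⟩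
      · rw [sup_sdiff]
        refine sup_le (sdiff_le_sdiff_right sdiff_le) ?_
        rw [sdiff_eq_bot_iff.2 ((SimpleGraph.edge_le_iff _).2 (.inr huv))]
        exact bot_le
      · have h1 : s(x, y) ∈ (I \ J).edgeSet := by simp [hxy, hxyJ]
        have h2 := hc h1
        simp only [SimpleGraph.mem_edgeSet, SimpleGraph.sdiff_adj, SimpleGraph.sup_adj, hI',
          SimpleGraph.edge_adj] at h2
        rcases h2 with ⟨h2 | h2, -⟩
        · exact h2.2 ⟨by simp, hxy.ne⟩
        · rcases h2.1 with ⟨rfl, rfl⟩ | ⟨rfl, rfl⟩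
          exacts [hxyJ huv, hxyJ huv.symm]
    · rw [SimpleGraph.edgeSet_sup]
      exact hfin.union ((Set.finite_singleton s(u, v)).subset SimpleGraph.edgeSet_edge_subset)
    · exact adj_sup_le (fun a b hab => h a b hab.1)
        (edge_adj_le (SimpleGraph.Adj.reachable (.inl huv)))

/-- A spanning set which is not larger than an independent set it spans is independent. -/
lemma indep_of_ncard_le {W I J : SimpleGraph V} (hI : Indep W I) (hIf : I.edgeSet.Finite)
    (hJf : J.edgeSet.Finite) (h : I.Adj ≤ (J ⊔ W).Reachable)
    (hcard : J.edgeSet.ncard ≤ I.edgeSet.ncard) : Indep W J := by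
  intro u v huv hr
  have h1 : J.Adj ≤ (J \ SimpleGraph.edge u v ⊔ W).Reachable := by
    rw [← sdiff_edge_sup_edge huv]
    refine adj_sup_le ?_ (edge_adj_le (by rwa [sdiff_edge_sup_edge huv]))
    refine adj_le_reachable_of_le ?_
    rw [sdiff_edge_sup_edge huv]
    exact le_sup_left
  have h2 := hI.ncard_le hIf (finite_edgeSet_of_le hJf sdiff_le)
    (fun a b hab => reachable_of_adj_le
      (adj_sup_le h1 (adj_le_reachable_of_le le_sup_right)) (h a b hab))
  have := edgeSet_sdiff_edge_ncard hJf huv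
  omega

lemma finite_setOf_le {A : SimpleGraph V} (hA : A.edgeSet.Finite) :
    {X : SimpleGraph V | X ≤ A}.Finite := by
  refine Set.Finite.of_finite_image (f := SimpleGraph.edgeSet) (hA.finite_subsets.subset ?_)
    SimpleGraph.edgeSet_injective.injOn
  rintro _ ⟨X, hX, rfl⟩
  exact SimpleGraph.edgeSet_mono hX

lemma finite_bases {W A : SimpleGraph V} (hA : A.edgeSet.Finite) : (bases W A).Finite :=
  (finite_setOf_le hA).subset fun _ h => h.1

/-- A spanning subset that is minimal under inclusion is independent, since an edge whose endpoints
stay connected without it could be dropped. -/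
lemma bases_nonempty {W A : SimpleGraph V} (hA : A.edgeSet.Finite) : (bases W A).Nonempty := by
  have hfin : {X : SimpleGraph V | X ≤ A ∧ A.Adj ≤ (X ⊔ W).Reachable}.Finite :=
    (finite_setOf_le hA).subset fun _ h => h.1
  obtain ⟨X, hX⟩ := hfin.exists_minimal ⟨A, le_rfl, adj_le_reachable_of_le le_sup_left⟩
  refine ⟨X, hX.1.1, hX.1.2, fun u v huv hr => ?_⟩
  have h1 : X.Adj ≤ (X \ SimpleGraph.edge u v ⊔ W).Reachable := by
    intro a b hab
    rcases reachable_sdiff_edge huv (SimpleGraph.Adj.reachable (.inl hab : (X ⊔ W).Adj a b)) with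
      h | h | h
    exacts [h, (h.1.trans hr).trans h.2, (h.1.trans hr.symm).trans h.2]
  have h2 := hX.2 (y := X \ SimpleGraph.edge u v) ⟨sdiff_le.trans hX.1.1, fun a b hab =>
    reachable_of_adj_le (adj_sup_le h1 (adj_le_reachable_of_le le_sup_right))
      (hX.1.2 a b hab)⟩ sdiff_le
  have := h2 huv
  simp [SimpleGraph.edge_adj, huv.ne] at this

/-- Replacing the edge `xy` of a base by an edge `uv` between the two sides. -/
lemma swap_mem_bases {W A X : SimpleGraph V} {x y u v : V} (hX : X ∈ bases W A)
    (hxy : X.Adj x y) (huv : A.Adj u v)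
    (hux : (X \ SimpleGraph.edge x y ⊔ W).Reachable x u)
    (hvy : (X \ SimpleGraph.edge x y ⊔ W).Reachable y v) :
    X \ SimpleGraph.edge x y ⊔ SimpleGraph.edge u v ∈ bases W A ∧
    (X \ SimpleGraph.edge x y ⊔ SimpleGraph.edge u v).Adj u v ∧
    (X \ SimpleGraph.edge x y ⊔ SimpleGraph.edge u v) \ SimpleGraph.edge u v =
      X \ SimpleGraph.edge x y := by
  obtain ⟨hXA, hsp, hind⟩ := hX
  have hr : ¬ (X \ SimpleGraph.edge x y ⊔ W).Reachable u v := fun hr =>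
    hind x y hxy ((hux.trans hr).trans hvy.symm)
  have hn : ¬ (X \ SimpleGraph.edge x y).Adj u v := fun h => hr (SimpleGraph.Adj.reachable (.inl h))
  refine ⟨⟨sup_le (sdiff_le.trans hXA) ((SimpleGraph.edge_le_iff _).2 (.inr huv)), ?_,
    (hind.mono sdiff_le le_rfl).sup_edge hr⟩, .inr (by simp [SimpleGraph.edge_adj, huv.ne]),
    sup_edge_sdiff_edge hn⟩
  have hle : X \ SimpleGraph.edge x y ⊔ W ≤ X \ SimpleGraph.edge x y ⊔ SimpleGraph.edge u v ⊔ W :=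
    sup_le_sup_right le_sup_left _
  have hE : (X \ SimpleGraph.edge x y ⊔ SimpleGraph.edge u v ⊔ W).Reachable x y :=
    ((hux.mono hle).trans (SimpleGraph.Adj.reachable
      (.inl (.inr (by simp [SimpleGraph.edge_adj, huv.ne]))))).trans (hvy.mono hle).symm
  intro a b hab
  rcases reachable_sdiff_edge hxy (hsp a b hab) with h | h | h
  · exact h.mono hle
  · exact ((h.1.mono hle).trans hE).trans (h.2.mono hle)
  · exact ((h.1.mono hle).trans hE.symm).trans (h.2.mono hle)

/-! ### Rayleigh monotonicity -/

/-- The two sides of `X` minus the edge `xy` contain `u` and `v` respectively. -/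
def Crosses (W X : SimpleGraph V) (x y u v : V) : Prop :=
  X.Adj x y ∧ (X \ SimpleGraph.edge x y ⊔ W).Reachable x u ∧
    (X \ SimpleGraph.edge x y ⊔ W).Reachable y v

/-- Exchanging `xy` for `uv` is injective, because deleting the new edge recovers the base minus
`xy`. With the converse inequality this is the reciprocity law of electrical networks. -/
lemma ncard_crosses_le {W A : SimpleGraph V} (hA : A.edgeSet.Finite) {x y u v : V}
    (huv : A.Adj u v) :
    {X ∈ bases W A | Crosses W X x y u v}.ncard ≤ {X ∈ bases W A | Crosses W X u v x y}.ncard := by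
  refine Set.ncard_le_ncard_of_injOn
    (fun X => X \ SimpleGraph.edge x y ⊔ SimpleGraph.edge u v) ?_ ?_
    ((finite_bases hA).subset fun _ h => h.1)
  · rintro X ⟨hX, hc⟩
    obtain ⟨h1, h2, h3⟩ := swap_mem_bases hX hc.1 huv hc.2.1 hc.2.2
    exact ⟨h1, h2, by rw [h3]; exact hc.2.1.symm, by rw [h3]; exact hc.2.2.symm⟩
  · rintro X ⟨hX, hc⟩ Y ⟨hY, hc'⟩ h
    have h3 := (swap_mem_bases hX hc.1 huv hc.2.1 hc.2.2).2.2
    have h3' := (swap_mem_bases hY hc'.1 huv hc'.2.1 hc'.2.2).2.2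
    dsimp only at h
    rw [← sdiff_edge_sup_edge hc.1, ← sdiff_edge_sup_edge hc'.1, ← h3, ← h3', h]

lemma ncard_crosses_comm {W A : SimpleGraph V} (hA : A.edgeSet.Finite) {x y u v : V}
    (hxy : A.Adj x y) (huv : A.Adj u v) :
    {X ∈ bases W A | Crosses W X x y u v}.ncard = {X ∈ bases W A | Crosses W X u v x y}.ncard :=
  (ncard_crosses_le hA huv).antisymm (ncard_crosses_le hA hxy)

lemma finite_darts {A : SimpleGraph V} (hA : A.edgeSet.Finite) :
    {d : V × V | A.Adj d.1 d.2}.Finite := by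
  have h : {d : V × V | A.Adj d.1 d.2} ⊆ ⋃ e ∈ A.edgeSet, {d | s(d.1, d.2) = e} := by
    rintro ⟨a, b⟩ hab
    simpa using hab
  refine (hA.biUnion fun e _ => ?_).subset h
  induction e with
  | _ a b =>
    refine (Set.toFinite {(a, b), (b, a)}).subset ?_
    rintro ⟨c, d⟩ hcd
    simp only [Set.mem_ofPred_eq, Sym2.eq_iff] at hcd
    simpa using hcd

open Classical in
/-- The unit flow along the path of a base from `x` to `z`, tested against `φ`. -/
lemma sum_crosses_of_reachable {W A T : SimpleGraph V} (hA : A.edgeSet.Finite)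
    (hT : T ∈ bases W A) {φ : V → ℝ} (hφ : ∀ u v, W.Adj u v → φ u = φ v) {x z : V}
    (hxz : (T ⊔ W).Reachable x z) :
    ∑ d ∈ (finite_darts hA).toFinset,
      (if Crosses W T d.1 d.2 x z then φ d.1 - φ d.2 else 0) = φ x - φ z := by
  rw [SimpleGraph.reachable_iff_reflTransGen] at hxz
  induction hxz with
  | refl =>
    rw [sub_self]
    refine Finset.sum_eq_zero fun d _ => if_neg fun h => ?_
    exact hT.2.2 _ _ h.1 (h.2.1.trans h.2.2.symm)
  | @tail z z' hxz hzz' ih =>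
    rw [← SimpleGraph.reachable_iff_reflTransGen] at hxz
    rcases hzz' with hzz' | hzz'
    · set R := T \ SimpleGraph.edge z z' ⊔ W with hR
      have hR' : T \ SimpleGraph.edge z' z ⊔ W = R := by rw [hR, SimpleGraph.edge_comm]
      have hn : ¬ R.Reachable z z' := hT.2.2 _ _ hzz'
      -- Moving the endpoint of the path from `z` to its neighbour `z'` changes the crossing
      -- indicator only at the two orientations of the edge `zz'`.
      have hpt : ∀ d : V × V, (if Crosses W T d.1 d.2 x z' then φ d.1 - φ d.2 else 0) =
          (if Crosses W T d.1 d.2 x z then φ d.1 - φ d.2 else 0) +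
          (if d = (z, z') then (if R.Reachable x z then φ z - φ z' else 0) else 0) -
          (if d = (z', z) then (if R.Reachable x z' then φ z' - φ z else 0) else 0) := by
        rintro ⟨a, b⟩
        by_cases h0 : (a, b) = (z, z')
        · obtain ⟨rfl, rfl⟩ := Prod.mk.inj h0
          have e1 : ¬ Crosses W T a b x a := fun h => hn h.2.2.symm
          have e2 : Crosses W T a b x b ↔ R.Reachable x a :=
            ⟨fun h => h.2.1.symm, fun h => ⟨hzz', h.symm, .rfl⟩⟩
          have e3 : (a, b) ≠ (b, a) := fun h => hzz'.ne (Prod.mk.inj h).1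
          simp only [e1, e2, e3, if_true, if_false]
          ring
        · by_cases h1 : (a, b) = (z', z)
          · obtain ⟨rfl, rfl⟩ := Prod.mk.inj h1
            have e1 : ¬ Crosses W T a b x a := fun h => hn (by rw [← hR']; exact h.2.2)
            have e2 : Crosses W T a b x b ↔ R.Reachable x a :=
              ⟨fun h => by rw [← hR']; exact h.2.1.symm,
                fun h => ⟨hzz'.symm, by rw [hR']; exact h.symm, .rfl⟩⟩
            simp only [e1, e2, h0, if_true, if_false]
            ring
          · have hadj : (T \ SimpleGraph.edge a b ⊔ W).Reachable z z' := by
              refine SimpleGraph.Adj.reachable (.inl ⟨hzz', fun h => ?_⟩)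
              rw [SimpleGraph.edge_adj] at h
              rcases h.1 with ⟨rfl, rfl⟩ | ⟨rfl, rfl⟩
              exacts [h0 rfl, h1 rfl]
            have e : Crosses W T a b x z' ↔ Crosses W T a b x z :=
              ⟨fun h => ⟨h.1, h.2.1, h.2.2.trans hadj.symm⟩,
                fun h => ⟨h.1, h.2.1, h.2.2.trans hadj⟩⟩
            simp only [e, h0, h1, if_false]
            ring
      have hm : (z, z') ∈ (finite_darts hA).toFinset := by simpa using hT.1 hzz'
      have hm' : (z', z) ∈ (finite_darts hA).toFinset := by simpa using hT.1 hzz'.symm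
      simp_rw [hpt]
      rw [Finset.sum_sub_distrib, Finset.sum_add_distrib, ih, Finset.sum_ite_eq',
        Finset.sum_ite_eq', if_pos hm, if_pos hm']
      -- If `x` is on the side of `z`, the path gains the step from `z` to `z'`. If `x` is on the
      -- side of `z'`, the path to `z` ended with the reverse step, which is now removed. The middle
      -- case would join `z` to `z'` without their edge.
      rcases reachable_sdiff_edge hzz' hxz with h | h | h
      · rw [if_pos h, if_neg fun h' => hn (h.symm.trans h')]; ring
      · exact absurd h.2.symm hn
      · rw [if_neg fun h' => hn (h'.symm.trans h.1), if_pos h.1]; ring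
    · rw [← hφ _ _ hzz', ← ih]
      refine Finset.sum_congr rfl fun d _ => ?_
      have hr : (T \ SimpleGraph.edge d.1 d.2 ⊔ W).Reachable z z' :=
        SimpleGraph.Adj.reachable (.inr hzz')
      have e : Crosses W T d.1 d.2 x z' ↔ Crosses W T d.1 d.2 x z :=
        ⟨fun h => ⟨h.1, h.2.1, h.2.2.trans hr.symm⟩, fun h => ⟨h.1, h.2.1, h.2.2.trans hr⟩⟩
      simp only [e]

open Classical in
/-- The voltage between the endpoints of `xy`, and the weak form of Kirchhoff's node law. -/
lemma exists_potential {W A : SimpleGraph V} (hA : A.edgeSet.Finite) {x y : V}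
    (hxy : A.Adj x y) :
    ∃ h : V → ℝ, (∀ u v, W.Adj u v → h u = h v) ∧
      h x - h y = {X ∈ bases W A | X.Adj x y}.ncard ∧
      ∀ φ : V → ℝ, (∀ u v, W.Adj u v → φ u = φ v) →
        ∑ d ∈ (finite_darts hA).toFinset, (h d.1 - h d.2) * (φ d.1 - φ d.2) =
          2 * ((bases W A).ncard * (φ x - φ y)) := by
  have hB := finite_bases (W := W) hA
  have hcard : ∀ p : SimpleGraph V → Prop, ({X ∈ bases W A | p X}.ncard : ℝ) =
      ∑ X ∈ hB.toFinset, if p X then 1 else 0 := by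
    intro p
    rw [Finset.sum_boole, ← Set.ncard_coe_finset]
    congr 2
    ext X
    simp
  set r : SimpleGraph V → V → V → Prop := fun X u v =>
    (X \ SimpleGraph.edge x y ⊔ W).Reachable u v with hr
  -- The potential at `v` counts the bases containing `xy` in which `v` is on the side of `x` once
  -- `xy` is deleted. At `y` it vanishes by independence.
  refine ⟨fun v => {X ∈ bases W A | X.Adj x y ∧ r X x v}.ncard, ?_, ?_, ?_⟩
  · intro u v huv
    have hs : ∀ X, r X u v := fun X =>
      SimpleGraph.Adj.reachable (Or.inr huv : (X \ SimpleGraph.edge x y ⊔ W).Adj u v)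
    have : ∀ X, r X x u ↔ r X x v := fun X =>
      ⟨fun h => SimpleGraph.Reachable.trans h (hs X),
        fun h => SimpleGraph.Reachable.trans h (SimpleGraph.Reachable.symm (hs X))⟩
    simp only [this]
  · have h1 : {X ∈ bases W A | X.Adj x y ∧ r X x x} = {X ∈ bases W A | X.Adj x y} := by
      ext X; simp [hr]
    have h2 : {X ∈ bases W A | X.Adj x y ∧ r X x y} = ∅ := by
      ext X
      simp only [Set.mem_ofPred_eq, Set.mem_empty_iff_false, iff_false]
      rintro ⟨hX, hadj, h⟩
      exact hX.2.2 _ _ hadj h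
    simp only [h1, h2, Set.ncard_empty, Nat.cast_zero, sub_zero]
  · intro φ hφ
    -- Ohm's law: by reciprocity, the potential drop along a dart is the net number of bases whose
    -- path from `x` to `y` uses that dart.
    have hdiff : ∀ d ∈ (finite_darts hA).toFinset,
        ({X ∈ bases W A | X.Adj x y ∧ r X x d.1}.ncard : ℝ) -
          {X ∈ bases W A | X.Adj x y ∧ r X x d.2}.ncard =
        {X ∈ bases W A | Crosses W X d.1 d.2 x y}.ncard -
          {X ∈ bases W A | Crosses W X d.2 d.1 x y}.ncard := by
      rintro ⟨u, v⟩ hd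
      have huv : A.Adj u v := by simpa using hd
      rw [← ncard_crosses_comm hA hxy huv, ← ncard_crosses_comm hA hxy huv.symm]
      simp only [hcard, ← Finset.sum_sub_distrib]
      refine Finset.sum_congr rfl fun X hX => ?_
      rw [Set.Finite.mem_toFinset] at hX
      by_cases hadj : X.Adj x y
      · have hn : ¬ r X x y := hX.2.2 _ _ hadj
        simp only [Crosses, hadj, true_and]
        change (if r X x u then (1 : ℝ) else 0) - (if r X x v then 1 else 0) =
          (if r X x u ∧ r X y v then 1 else 0) - (if r X x v ∧ r X y u then 1 else 0)
        have tr : ∀ {a b c}, r X a b → r X b c → r X a c := fun h h' => h.trans h'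
        have sy : ∀ {a b}, r X a b → r X b a := fun h => h.symm
        rcases reachable_sdiff_edge hadj (hX.2.1 u v huv) with h | h | h
        · change r X u v at h
          have e1 : r X x u ↔ r X x v := ⟨fun h' => tr h' h, fun h' => tr h' (sy h)⟩
          have e2 : ¬ (r X x u ∧ r X y v) := fun h' => hn (tr (e1.1 h'.1) (sy h'.2))
          have e3 : ¬ (r X x v ∧ r X y u) := fun h' => hn (tr (e1.2 h'.1) (sy h'.2))
          rw [if_neg e2, if_neg e3]
          simp only [e1, sub_self]
        · obtain ⟨h1, h2⟩ : r X u x ∧ r X y v := h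
          have e1 : r X x u := sy h1
          have e2 : ¬ r X x v := fun h' => hn (tr h' (sy h2))
          simp only [e1, e2, h2, if_true, if_false, false_and, and_self]
        · obtain ⟨h1, h2⟩ : r X u y ∧ r X x v := h
          have e1 : ¬ r X x u := fun h' => hn (tr h' h1)
          have e2 : r X y u := sy h1
          simp only [e1, e2, h2, if_true, if_false, false_and, and_self]
      · simp [Crosses, hadj]
    have hflow : ∑ d ∈ (finite_darts hA).toFinset,
        ({X ∈ bases W A | Crosses W X d.1 d.2 x y}.ncard : ℝ) * (φ d.1 - φ d.2) =
          (bases W A).ncard * (φ x - φ y) := by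
      simp only [hcard, Finset.sum_mul, ite_mul, one_mul, zero_mul]
      rw [Finset.sum_comm, Finset.sum_congr rfl fun T hT => sum_crosses_of_reachable hA
        ((Set.Finite.mem_toFinset _).1 hT) hφ (((Set.Finite.mem_toFinset _).1 hT).2.1 x y hxy),
        Finset.sum_const, nsmul_eq_mul, Set.ncard_eq_toFinset_card _ hB]
    -- Reversing all darts yields a second copy of the same flow. This is the factor 2 in the
    -- conclusion.
    have hswap : ∑ d ∈ (finite_darts hA).toFinset,
        ({X ∈ bases W A | Crosses W X d.2 d.1 x y}.ncard : ℝ) * (φ d.1 - φ d.2) =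
          - ((bases W A).ncard * (φ x - φ y)) := by
      rw [← hflow, ← Finset.sum_neg_distrib]
      refine Finset.sum_bij' (fun d _ => d.swap) (fun d _ => d.swap) ?_ ?_ ?_ ?_ ?_
      · intro d hd; simpa using SimpleGraph.Adj.symm (by simpa using hd : A.Adj d.1 d.2)
      · intro d hd; simpa using SimpleGraph.Adj.symm (by simpa using hd : A.Adj d.1 d.2)
      · intro d _; exact d.swap_swap
      · intro d _; exact d.swap_swap
      · intro d _
        simp only [Prod.fst_swap, Prod.snd_swap]
        ring
    rw [Finset.sum_congr rfl fun d hd => by rw [hdiff d hd, sub_mul], Finset.sum_sub_distrib,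
      hflow, hswap]
    ring

/-- **Rayleigh monotonicity**: the probability of an edge decreases under adding edges and
contracting. -/
lemma rayleigh {W W' A A' : SimpleGraph V} (hA' : A'.edgeSet.Finite) (hW : W ≤ W') (hA : A ≤ A')
    {x y : V} (hxy : A.Adj x y) :
    {X ∈ bases W' A' | X.Adj x y}.ncard * (bases W A).ncard ≤
      {X ∈ bases W A | X.Adj x y}.ncard * (bases W' A').ncard := by
  have hAf := finite_edgeSet_of_le hA' hA
  obtain ⟨h, hh, hM, hflow⟩ := exists_potential (W := W) hAf hxy
  obtain ⟨h', hh', hM', hflow'⟩ := exists_potential (W := W') hA' (hA hxy)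
  have hh'W : ∀ u v, W.Adj u v → h' u = h' v := fun u v huv => hh' u v (hW huv)
  -- In terms of the energy form on `A`: `h` with itself gives `2NM`, and `h` with `h'` gives
  -- `2NM'`, where `h'` is admissible because it is constant along the smaller `W`. On `A'`, `h'`
  -- with itself gives `2N'M'`.
  have e1 := hflow h hh
  have e2 := hflow h' hh'W
  have e3 := hflow' h' hh'
  rw [hM] at e1
  rw [hM'] at e2 e3
  have hN : 0 < ((bases W A).ncard : ℝ) := by
    exact_mod_cast (Set.ncard_pos (finite_bases hAf)).2 (bases_nonempty hAf)
  have hN' : 0 < ((bases W' A').ncard : ℝ) := by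
    exact_mod_cast (Set.ncard_pos (finite_bases hA')).2 (bases_nonempty hA')
  set N : ℝ := ((bases W A).ncard : ℝ)
  set N' : ℝ := ((bases W' A').ncard : ℝ)
  set M : ℝ := ({X ∈ bases W A | X.Adj x y}.ncard : ℝ)
  set M' : ℝ := ({X ∈ bases W' A' | X.Adj x y}.ncard : ℝ)
  have e4 : ∑ d ∈ (finite_darts hAf).toFinset, (h' d.1 - h' d.2) * (h' d.1 - h' d.2) ≤
      2 * (N' * M') := by
    rw [← e3]
    refine Finset.sum_le_sum_of_subset_of_nonneg ?_ fun d _ _ => mul_self_nonneg _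
    intro d hd
    simp only [Set.Finite.mem_toFinset, Set.mem_ofPred_eq] at hd ⊢
    exact hA hd
  -- The energy on `A` of `N' h - N h'` is nonnegative. Expanding it and bounding the energy of `h'`
  -- on `A` by its energy on `A'` leaves `2NN'(MN' - M'N)`.
  have e5 : 0 ≤ ∑ d ∈ (finite_darts hAf).toFinset,
      (N' * (h d.1 - h d.2) - N * (h' d.1 - h' d.2)) ^ 2 :=
    Finset.sum_nonneg fun d _ => sq_nonneg _
  have e6 : ∑ d ∈ (finite_darts hAf).toFinset,
      (N' * (h d.1 - h d.2) - N * (h' d.1 - h' d.2)) ^ 2 =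
      N' ^ 2 * (2 * (N * M)) - 2 * N * N' * (2 * (N * M')) + N ^ 2 *
        ∑ d ∈ (finite_darts hAf).toFinset, (h' d.1 - h' d.2) * (h' d.1 - h' d.2) := by
    rw [← e1, ← e2, Finset.mul_sum, Finset.mul_sum, Finset.mul_sum, ← Finset.sum_sub_distrib,
      ← Finset.sum_add_distrib]
    exact Finset.sum_congr rfl fun d _ => by ring
  have e7 : 0 ≤ 2 * N * N' * (M * N' - M' * N) := by
    have := mul_le_mul_of_nonneg_left e4 (sq_nonneg N)
    nlinarith
  have e8 : 0 ≤ M * N' - M' * N := by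
    by_contra hc
    push Not at hc
    have : 2 * N * N' * (M * N' - M' * N) < 0 := mul_neg_of_pos_of_neg (by positivity) hc
    linarith
  have e9 : M' * N ≤ M * N' := by linarith
  exact (Nat.cast_le (α := ℝ)).1 (by push_cast; exact e9)

/-! ### Negative association -/

/-- The bases containing all the edges in `s`. -/
def basesWith (W A : SimpleGraph V) (s : Finset (Sym2 V)) : Set (SimpleGraph V) :=
  {X ∈ bases W A | ↑s ⊆ X.edgeSet}

/-- The probability that a uniform base contains all the edges in `s`. -/
noncomputable def basesProb (W A : SimpleGraph V) (s : Finset (Sym2 V)) : ℝ≥0∞ :=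
  (basesWith W A s).ncard / (bases W A).ncard

lemma basesWith_empty (W A : SimpleGraph V) : basesWith W A ∅ = bases W A := by
  simp [basesWith]

lemma finite_basesWith {W A : SimpleGraph V} (hA : A.edgeSet.Finite) (s : Finset (Sym2 V)) :
    (basesWith W A s).Finite := (finite_bases hA).subset fun _ h => h.1

lemma ncard_bases_ne_zero {W A : SimpleGraph V} (hA : A.edgeSet.Finite) :
    ((bases W A).ncard : ℝ≥0∞) ≠ 0 := by
  exact_mod_cast ((Set.ncard_pos (finite_bases hA)).2 (bases_nonempty hA)).ne'

lemma basesProb_empty {W A : SimpleGraph V} (hA : A.edgeSet.Finite) :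
    basesProb W A ∅ = 1 := by
  rw [basesProb, basesWith_empty]
  exact ENNReal.div_self (ncard_bases_ne_zero hA) (ENNReal.natCast_ne_top _)

lemma basesProb_le_one {W A : SimpleGraph V} (hA : A.edgeSet.Finite) (s : Finset (Sym2 V)) :
    basesProb W A s ≤ 1 := by
  refine ENNReal.div_le_of_le_mul ?_
  rw [one_mul]
  exact_mod_cast Set.ncard_le_ncard (show basesWith W A s ⊆ bases W A from fun _ h => h.1)
    (finite_bases hA)

lemma basesProb_eq_zero {W A : SimpleGraph V} {s : Finset (Sym2 V)} (h : basesWith W A s = ∅) :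
    basesProb W A s = 0 := by
  simp [basesProb, h]

lemma basesWith_eq_empty_of_not_subset {W A : SimpleGraph V} {s : Finset (Sym2 V)}
    (h : ¬ ↑s ⊆ A.edgeSet) : basesWith W A s = ∅ := by
  ext X
  simp only [Set.mem_empty_iff_false, iff_false]
  exact fun hX => h (hX.2.trans (SimpleGraph.edgeSet_mono hX.1.1))

lemma basesWith_eq_empty_of_reachable {W A : SimpleGraph V} {s : Finset (Sym2 V)} {x y : V}
    (hxy : s(x, y) ∈ s) (h : W.Reachable x y) : basesWith W A s = ∅ := by
  ext X
  simp only [Set.mem_empty_iff_false, iff_false]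
  exact fun hX => hX.1.2.2 x y (by simpa using hX.2 hxy) (h.mono le_sup_right)

/-- A set independent after contracting `xy` does not connect `x` and `y`. -/
lemma Indep.not_reachable {W Y : SimpleGraph V} {x y : V} (hYf : Y.edgeSet.Finite)
    (hY : Indep (W ⊔ SimpleGraph.edge x y) Y) (hxy : ¬ W.Reachable x y) :
    ¬ (Y ⊔ W).Reachable x y := by
  intro hr
  -- In a minimal part `Z` of `Y` joining `x` to `y` over `W`, every edge separates `x` from `y`.
  -- With `xy` contracted, the endpoints of such an edge are joined without it, so `Y` is dependent.
  have hfin : {Z : SimpleGraph V | Z ≤ Y ∧ (Z ⊔ W).Reachable x y}.Finite :=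
    (finite_setOf_le hYf).subset fun _ h => h.1
  obtain ⟨Z, hZ⟩ := hfin.exists_minimal ⟨Y, le_rfl, hr⟩
  have hZb : Z ≠ ⊥ := by
    rintro rfl
    exact hxy (by simpa using hZ.1.2)
  obtain ⟨u, v, huv⟩ := SimpleGraph.ne_bot_iff_exists_adj.1 hZb
  have hn : ¬ (Z \ SimpleGraph.edge u v ⊔ W).Reachable x y := fun h => by
    have := hZ.2 (y := Z \ SimpleGraph.edge u v) ⟨sdiff_le.trans hZ.1.1, h⟩ sdiff_le huv
    simp [SimpleGraph.edge_adj, huv.ne] at this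
  have hle : Z \ SimpleGraph.edge u v ⊔ W ≤
      Z \ SimpleGraph.edge u v ⊔ (W ⊔ SimpleGraph.edge x y) := sup_le_sup_left le_sup_left _
  have hxy' : x ≠ y := fun h => hxy (h ▸ .rfl)
  have he : (Z \ SimpleGraph.edge u v ⊔ (W ⊔ SimpleGraph.edge x y)).Reachable x y :=
    SimpleGraph.Adj.reachable (.inr (.inr (by simp [SimpleGraph.edge_adj, hxy'])))
  refine hY.mono hZ.1.1 le_rfl u v huv ?_
  rcases reachable_sdiff_edge huv hZ.1.2 with h | h | h
  · exact absurd h hn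
  · exact ((h.1.mono hle).symm.trans he).trans (h.2.mono hle).symm
  · exact ((h.2.mono hle).trans he.symm).trans (h.1.mono hle)

open Classical in
/-- Bases containing an edge correspond to bases after contracting it. -/
lemma ncard_basesWith_insert {W A : SimpleGraph V} (hA : A.edgeSet.Finite) {x y : V}
    (hxy : A.Adj x y) (hW : ¬ W.Reachable x y) {s : Finset (Sym2 V)} (hs : s(x, y) ∉ s) :
    (basesWith W A (insert s(x, y) s)).ncard =
      (basesWith (W ⊔ SimpleGraph.edge x y) A s).ncard := by
  have hins : ∀ {X}, X ∈ basesWith W A (insert s(x, y) s) → X.Adj x y := fun hX => by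
    simpa using hX.2 (by simp : s(x, y) ∈ _)
  have hnot : ∀ {Y}, Y ∈ basesWith (W ⊔ SimpleGraph.edge x y) A s → ¬ Y.Adj x y := fun hY h =>
    hY.1.2.2 x y h (SimpleGraph.Adj.reachable
      (.inr (.inr (by simp [SimpleGraph.edge_adj, h.ne]))))
  refine Set.ncard_congr (fun X _ => X \ SimpleGraph.edge x y) ?_ ?_ ?_
  · intro X hX
    have hadj := hins hX
    refine ⟨⟨sdiff_le.trans hX.1.1, ?_, ?_⟩, ?_⟩
    · rw [← sup_assoc, sup_right_comm, sdiff_edge_sup_edge hadj]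
      exact hX.1.2.1
    · intro u v huv hr
      refine hX.1.2.2 u v huv.1 (hr.mono ?_)
      rw [← sup_assoc, sup_right_comm]
      refine sup_le_sup_right (sup_le (sdiff_le_sdiff_right sdiff_le) ?_) _
      intro a b hab
      rw [SimpleGraph.edge_adj] at hab
      have h2 := huv.2
      simp only [SimpleGraph.sdiff_adj, SimpleGraph.edge_adj, not_and, not_not] at h2 ⊢
      rcases hab.1 with ⟨rfl, rfl⟩ | ⟨rfl, rfl⟩
      · refine ⟨hadj, fun h => ?_⟩
        rcases h with ⟨rfl, rfl⟩ | ⟨rfl, rfl⟩ <;> exact absurd (h2 (by simp)) huv.1.ne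
      · refine ⟨hadj.symm, fun h => ?_⟩
        rcases h with ⟨rfl, rfl⟩ | ⟨rfl, rfl⟩ <;> exact absurd (h2 (by simp)) huv.1.ne
    · intro e he
      rw [SimpleGraph.edgeSet_sdiff, SimpleGraph.edgeSet_edge_of_ne hadj.ne]
      refine ⟨hX.2 (by simp [Finset.mem_coe.1 he]), ?_⟩
      rintro rfl
      exact hs he
  · intro X Y hX hY h
    rw [← sdiff_edge_sup_edge (hins hX), ← sdiff_edge_sup_edge (hins hY), h]
  · intro Y hY
    refine ⟨Y ⊔ SimpleGraph.edge x y, ⟨⟨?_, ?_, ?_⟩, ?_⟩, sup_edge_sdiff_edge (hnot hY)⟩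
    · exact sup_le hY.1.1 ((SimpleGraph.edge_le_iff _).2 (.inr hxy))
    · rw [sup_right_comm, sup_assoc]
      exact hY.1.2.1
    · exact (hY.1.2.2.mono le_rfl le_sup_left).sup_edge
        (hY.1.2.2.not_reachable (finite_edgeSet_of_le hA hY.1.1) hW)
    · rw [Finset.coe_insert, SimpleGraph.edgeSet_sup, SimpleGraph.edgeSet_edge_of_ne hxy.ne]
      exact Set.insert_subset (.inr rfl) (hY.2.trans Set.subset_union_left)

open Classical in
-- The chain rule: conditioned on containing `xy`, a uniform base minus `xy` is a uniform base of
-- the contraction by `xy`.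
lemma basesProb_insert {W A : SimpleGraph V} (hA : A.edgeSet.Finite) {x y : V}
    (hxy : A.Adj x y) (hW : ¬ W.Reachable x y) {s : Finset (Sym2 V)} (hs : s(x, y) ∉ s) :
    basesProb W A (insert s(x, y) s) =
      basesProb W A {s(x, y)} * basesProb (W ⊔ SimpleGraph.edge x y) A s := by
  have h1 := ncard_basesWith_insert hA hxy hW hs
  have h2 := ncard_basesWith_insert hA hxy hW (Finset.notMem_empty _)
  rw [basesWith_empty] at h2
  rw [basesProb, basesProb, basesProb, h1, ← h2, insert_empty_eq, mul_comm,
    ENNReal.div_eq_inv_mul, ENNReal.div_eq_inv_mul, ENNReal.div_eq_inv_mul]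
  have h0 : ((basesWith W A {s(x, y)}).ncard : ℝ≥0∞) ≠ 0 := by
    rw [← insert_empty_eq, h2]
    exact ncard_bases_ne_zero hA
  calc _ = ((bases W A).ncard : ℝ≥0∞)⁻¹ *
      (basesWith (W ⊔ SimpleGraph.edge x y) A s).ncard * 1 := by rw [mul_one]
    _ = _ := by
      rw [← ENNReal.inv_mul_cancel h0 (ENNReal.natCast_ne_top _)]
      ring

lemma basesProb_singleton_le {W W' A A' : SimpleGraph V} (hA' : A'.edgeSet.Finite) (hW : W ≤ W')
    (hA : A ≤ A') {x y : V} (hxy : A.Adj x y) :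
    basesProb W' A' {s(x, y)} ≤ basesProb W A {s(x, y)} := by
  have hAf := finite_edgeSet_of_le hA' hA
  have h : ∀ W A : SimpleGraph V, basesWith W A {s(x, y)} = {X ∈ bases W A | X.Adj x y} := by
    intro W A
    ext X
    simp [basesWith]
  rw [basesProb, basesProb, h, h]
  rw [ENNReal.div_le_iff (ncard_bases_ne_zero hA') (ENNReal.natCast_ne_top _), div_eq_mul_inv,
    mul_right_comm, ← div_eq_mul_inv,
    ENNReal.le_div_iff_mul_le (.inl (ncard_bases_ne_zero hAf)) (.inl (ENNReal.natCast_ne_top _))]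
  exact_mod_cast rayleigh hA' hW hA hxy

open Classical in
-- The edges of `s` are peeled off by the chain rule and contracted in both graphs at once, each
-- factor being compared by Rayleigh monotonicity. What remains is `t` under a further contraction,
-- hence the uniform bound `c`. Taking `t` empty gives monotonicity; taking `t` to be the remaining
-- blocks gives product bounds.
lemma basesProb_union_le_mul {W₁ A₁ A : SimpleGraph V} (hA : A.edgeSet.Finite)
    (hA₁ : A₁ ≤ A) {s t : Finset (Sym2 V)} (hs : ↑s ⊆ A₁.edgeSet) (hst : Disjoint s t) {c : ℝ≥0∞}
    {W : SimpleGraph V} (hW₁ : W₁ ≤ W) (hc : ∀ W', W ≤ W' → basesProb W' A t ≤ c) :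
    basesProb W A (s ∪ t) ≤ basesProb W₁ A₁ s * c := by
  induction s using Finset.induction_on generalizing W W₁ with
  | empty =>
    rw [basesProb_empty (finite_edgeSet_of_le hA hA₁), one_mul, Finset.empty_union]
    exact hc W le_rfl
  | insert e s he ih =>
    induction e with
    | _ x y =>
    have hxy : A₁.Adj x y := by simpa using hs (by simp : s(x, y) ∈ _)
    rw [Finset.disjoint_insert_left] at hst
    -- If `xy` has become a loop of the larger contraction, no base contains it. Otherwise it is no
    -- loop of the smaller contraction either, and both chain rules apply.
    by_cases hr : W.Reachable x y
    · rw [basesProb_eq_zero (basesWith_eq_empty_of_reachable (by simp) hr)]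
      exact zero_le
    · have hr₁ : ¬ W₁.Reachable x y := fun h => hr (h.mono hW₁)
      rw [Finset.insert_union, basesProb_insert hA (hA₁ hxy) hr (by simp [he, hst.1]),
        basesProb_insert (finite_edgeSet_of_le hA hA₁) hxy hr₁ he, mul_assoc]
      refine mul_le_mul' (basesProb_singleton_le hA hW₁ hA₁ hxy) ?_
      refine ih (subset_trans (by simp) hs) hst.2 (sup_le_sup_right hW₁ _) fun W' hW' =>
        hc W' (le_sup_left.trans hW')

/-- The probability that given edges are present decreases under adding edges and contracting. -/
lemma basesProb_anti {W W' A A' : SimpleGraph V} (hA' : A'.edgeSet.Finite) (hW : W ≤ W')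
    (hA : A ≤ A') {s : Finset (Sym2 V)} (hs : ↑s ⊆ A.edgeSet) :
    basesProb W' A' s ≤ basesProb W A s := by
  classical
  simpa using basesProb_union_le_mul hA' hA hs (Finset.disjoint_empty_right s) hW
    (c := 1) fun W' _ => basesProb_le_one hA' _

open Classical in
/-- Negative association, in the form of a bound by a product over smaller graphs. -/
lemma basesProb_biUnion_le_prod {ι : Type*} {W A : SimpleGraph V} (hA : A.edgeSet.Finite)
    (I : Finset ι) (B : ι → SimpleGraph V) (hB : ∀ i ∈ I, B i ≤ A) (s : ι → Finset (Sym2 V))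
    (hs : ∀ i ∈ I, ↑(s i) ⊆ (B i).edgeSet)
    (hd : (I : Set ι).PairwiseDisjoint s) :
    basesProb W A (I.biUnion s) ≤ ∏ i ∈ I, basesProb W (B i) (s i) := by
  -- Treating one block contracts its edges, so the bound for the remaining blocks is needed over
  -- every larger contraction.
  suffices h : ∀ W', W ≤ W' → basesProb W' A (I.biUnion s) ≤ ∏ i ∈ I, basesProb W (B i) (s i) from
    h W le_rfl
  induction I using Finset.induction_on with
  | empty => exact fun W' _ => by simp [basesProb_empty hA]
  | insert i I hi ih =>
    intro W' hW'
    rw [Finset.biUnion_insert, Finset.prod_insert hi]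
    refine basesProb_union_le_mul hA (hB i (by simp)) (hs i (by simp)) ?_ hW' ?_
    · rw [Finset.disjoint_biUnion_right]
      intro j hj
      exact hd (by simp) (by simp [hj]) fun h => hi (h ▸ hj)
    · intro W'' hW''
      exact ih (fun j hj => hB j (by simp [hj])) (fun j hj => hs j (by simp [hj]))
        (hd.subset (by simp)) W'' (hW'.trans hW'')

/-! ### Conditioning on the connectivity of a finite part -/

lemma reachable_eq_of_spans {A X Y U : SimpleGraph V} (hX : X ≤ A) (hY : Y ≤ A)
    (hXs : A.Adj ≤ (X ⊔ U).Reachable) (hYs : A.Adj ≤ (Y ⊔ U).Reachable) :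
    (X ⊔ U).Reachable = (Y ⊔ U).Reachable := by
  ext a b
  exact ⟨reachable_of_adj_le (adj_sup_le (fun a b h => hYs a b (hX h))
      (adj_le_reachable_of_le le_sup_right)),
    reachable_of_adj_le (adj_sup_le (fun a b h => hXs a b (hY h))
      (adj_le_reachable_of_le le_sup_right))⟩

/-- Given the edges outside `A` and the connectivity inside `Q`, a base is determined by a base
of the contraction of `A`. -/
lemma ncard_fiber {W A₀ A Q T₀ : SimpleGraph V} (hA₀ : A₀.edgeSet.Finite) (hAA₀ : A ≤ A₀)
    (hAQ : A ≤ Q) (hT₀ : T₀ ∈ bases W A₀) (hAT₀ : A.Adj ≤ (T₀ ⊓ Q).Reachable)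
    {s : Finset (Sym2 V)} (hs : ↑s ⊆ A.edgeSet) :
    (basesWith ((T₀ \ A) ⊓ Q) A s).ncard =
      {T ∈ basesWith W A₀ s | T \ A = T₀ \ A ∧ (T ⊓ Q).Reachable = (T₀ ⊓ Q).Reachable}.ncard := by
  set U := T₀ \ A with hU
  have hUA : U \ A = U := by rw [hU, sdiff_idem]
  have hdisj : Disjoint U A := disjoint_sdiff_self_left
  have hinf : ∀ T, T \ A = U → T ⊓ Q = (T ⊓ A) ⊔ (U ⊓ Q) := by
    intro T hT
    conv_lhs => rw [← sup_inf_sdiff T A, hT, inf_sup_right, inf_assoc, inf_eq_left.2 hAQ]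
  have hA : A.edgeSet.Finite := finite_edgeSet_of_le hA₀ hAA₀
  have hT₀f : T₀.edgeSet.Finite := finite_edgeSet_of_le hA₀ hT₀.1
  have hX₀ : A.Adj ≤ (T₀ ⊓ A ⊔ U ⊓ Q).Reachable := by rw [← hinf T₀ rfl]; exact hAT₀
  -- Only `U ⊓ Q` is contracted, not all of `U` and `W`: fixing the connectivity inside `Q` makes
  -- connections through the rest irrelevant to which edges of `A` may be chosen.
  refine Set.ncard_congr (fun X _ => X ⊔ U) ?_ ?_ ?_
  · rintro X ⟨⟨hXA, hXs, hXi⟩, hsX⟩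
    have hXf : X.edgeSet.Finite := finite_edgeSet_of_le hA hXA
    have hTA : (X ⊔ U) \ A = U := by rw [sup_sdiff, hUA, sdiff_eq_bot_iff.2 hXA, bot_sup_eq]
    have hle : X ⊔ U ⊓ Q ≤ X ⊔ U ⊔ W := (sup_le_sup_left inf_le_left _).trans le_sup_left
    have hsp : T₀.Adj ≤ (X ⊔ U ⊔ W).Reachable := by
      rw [← sup_inf_sdiff T₀ A]
      exact adj_sup_le (fun a b h => (hXs a b h.2).mono hle)
        (adj_le_reachable_of_le (le_sup_right.trans le_sup_left))
    refine ⟨⟨⟨?_, ?_, ?_⟩, ?_⟩, hTA, ?_⟩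
    · exact sup_le (hXA.trans hAA₀) (sdiff_le.trans hT₀.1)
    · exact fun a b h => reachable_of_adj_le (adj_sup_le hsp
        (adj_le_reachable_of_le le_sup_right)) (hT₀.2.1 a b h)
    -- Independence by counting: `X ⊔ U` spans the independent `T₀`, and `X`, independent over `U ⊓
    -- Q`, has no more edges than `T₀ ⊓ A`, which spans it there.
    · refine indep_of_ncard_le hT₀.2.2 hT₀f ?_ hsp ?_
      · exact finite_edgeSet_of_le hA₀ (sup_le (hXA.trans hAA₀) (sdiff_le.trans hT₀.1))
      · have h1 := hXi.ncard_le hXf (finite_edgeSet_of_le hT₀f (inf_le_left (b := A)))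
          fun a b h => hX₀ a b (hXA h)
        have h2 : T₀.edgeSet.ncard = (T₀ ⊓ A).edgeSet.ncard + U.edgeSet.ncard := by
          conv_lhs => rw [← sup_inf_sdiff T₀ A, SimpleGraph.edgeSet_sup]
          refine Set.ncard_union_eq ?_ (finite_edgeSet_of_le hT₀f inf_le_left)
            (finite_edgeSet_of_le hT₀f sdiff_le)
          rw [SimpleGraph.disjoint_edgeSet]
          exact hdisj.symm.mono_left inf_le_right
        rw [h2, SimpleGraph.edgeSet_sup]
        exact (Set.ncard_union_le _ _).trans (by gcongr)
    · rw [SimpleGraph.edgeSet_sup]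
      exact hsX.trans Set.subset_union_left
    · rw [hinf _ hTA, hinf T₀ rfl]
      refine reachable_eq_of_spans inf_le_right inf_le_right (fun a b h => (hXs a b h).mono ?_) hX₀
      exact sup_le_sup_right (le_inf le_sup_left hXA) _
  · rintro X Y hX hY h
    have : ∀ {Z}, Z ∈ basesWith (U ⊓ Q) A s → (Z ⊔ U) ⊓ A = Z := fun hZ => by
      rw [inf_sup_right, hdisj.eq_bot, sup_bot_eq, inf_eq_left.2 hZ.1.1]
    rw [← this hX, ← this hY, h]
  · rintro T ⟨⟨⟨hTA₀, hTs, hTi⟩, hsT⟩, hTA, hTr⟩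
    refine ⟨T ⊓ A, ⟨⟨inf_le_right, ?_, ?_⟩, ?_⟩, ?_⟩
    · rw [← hinf T hTA, hTr]
      exact hAT₀
    · intro u v huv hr
      refine hTi u v huv.1 (hr.mono (le_sup_of_le_left (sup_le (sdiff_le_sdiff_right inf_le_left)
        (inf_le_left.trans ?_))))
      rw [← hTA]
      exact sdiff_le_sdiff_left ((SimpleGraph.edge_le_iff _).2 (.inr huv.2))
    · rw [SimpleGraph.edgeSet_inf]
      exact Set.subset_inter hsT hs
    · conv_rhs => rw [← sup_inf_sdiff T A, hTA]

open Classical in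
/-- On an event which only depends on the connectivity inside `Q` and implies that each edge
of `A` joins connected vertices, the probability of containing `s` is at most the one for a
uniform base of `A`. -/
lemma ncard_basesWith_le_mul {W A₀ A Q : SimpleGraph V} (hA₀ : A₀.edgeSet.Finite) (hAA₀ : A ≤ A₀)
    (hAQ : A ≤ Q) {s : Finset (Sym2 V)} (hs : ↑s ⊆ A.edgeSet) {p : SimpleGraph V → Prop}
    (hp : ∀ X Y : SimpleGraph V, X.Reachable = Y.Reachable → p X → p Y)
    (hpA : ∀ X, p X → A.Adj ≤ X.Reachable) :
    ({T ∈ basesWith W A₀ s | p (T ⊓ Q)}.ncard : ℝ≥0∞) ≤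
      basesProb ⊥ A s * {T ∈ bases W A₀ | p (T ⊓ Q)}.ncard := by
  have hA : A.edgeSet.Finite := finite_edgeSet_of_le hA₀ hAA₀
  have hf : ∀ s, {T ∈ basesWith W A₀ s | p (T ⊓ Q)}.Finite := fun s =>
    (finite_basesWith hA₀ s).subset fun _ h => h.1
  -- The bases are partitioned by their edges outside `A` and their connectivity inside `Q`. The
  -- property `p` is constant on each class, and within a class the trace on `A` is a uniform base
  -- of a contraction of `A`, to which monotonicity applies.
  set f : SimpleGraph V → SimpleGraph V × (V → V → Prop) := fun T => (T \ A, (T ⊓ Q).Reachable)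
  have key : ∀ s : Finset (Sym2 V), ↑s ⊆ A.edgeSet →
      {T ∈ basesWith W A₀ s | p (T ⊓ Q)}.ncard =
        ∑ b ∈ (hf ∅).toFinset.image f, {T ∈ basesWith W A₀ s | p (T ⊓ Q) ∧ f T = b}.ncard := by
    intro s _
    rw [Set.ncard_eq_toFinset_card _ (hf s), Finset.card_eq_sum_card_fiberwise (f := f)
      (t := (hf ∅).toFinset.image f)]
    · refine Finset.sum_congr rfl fun b _ => ?_
      rw [← Set.ncard_coe_finset]
      congr 1
      ext T
      simp [and_assoc]
    · intro T hT
      simp only [Set.Finite.coe_toFinset] at hT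
      simp only [Finset.coe_image, Set.Finite.coe_toFinset]
      exact ⟨T, ⟨⟨hT.1.1, by simp⟩, hT.2⟩, rfl⟩
  have h0 := key ∅ (by simp)
  rw [← basesWith_empty W A₀, key s hs, h0]
  push_cast
  rw [Finset.mul_sum]
  refine Finset.sum_le_sum fun b hb => ?_
  simp only [Finset.mem_image, Set.Finite.mem_toFinset] at hb
  obtain ⟨T₀, ⟨⟨hT₀, -⟩, hpT₀⟩, rfl⟩ := hb
  have hset : ∀ s : Finset (Sym2 V), {T ∈ basesWith W A₀ s | p (T ⊓ Q) ∧ f T = f T₀} =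
      {T ∈ basesWith W A₀ s | T \ A = T₀ \ A ∧ (T ⊓ Q).Reachable = (T₀ ⊓ Q).Reachable} := by
    intro s
    ext T
    simp only [Set.mem_ofPred_eq, f, Prod.mk.injEq, and_congr_right_iff, and_iff_right_iff_imp]
    exact fun _ h => hp _ _ h.2.symm hpT₀
  have h1 := ncard_fiber hA₀ hAA₀ hAQ hT₀ (hpA _ hpT₀) hs
  have h2 := ncard_fiber hA₀ hAA₀ hAQ hT₀ (hpA _ hpT₀) (s := ∅) (by simp)
  rw [hset, hset, ← h1, ← h2, basesWith_empty]
  rw [← ENNReal.div_le_iff (ncard_bases_ne_zero hA) (ENNReal.natCast_ne_top _)]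
  exact basesProb_anti hA bot_le le_rfl hs

/-! ### Spanning trees as bases -/

lemma indep_bot_iff_isAcyclic {X : SimpleGraph V} : Indep ⊥ X ↔ X.IsAcyclic := by
  rw [SimpleGraph.isAcyclic_iff_forall_adj_isBridge]
  simp only [Indep, SimpleGraph.isBridge_iff, sup_bot_eq]
  rfl

lemma reachable_induce {X : SimpleGraph V} {S : Set V} (hS : ∀ a b, X.Adj a b → a ∈ S → b ∈ S)
    {a b : V} (ha : a ∈ S) (h : X.Reachable a b) :
    ∃ hb : b ∈ S, (X.induce S).Reachable ⟨a, ha⟩ ⟨b, hb⟩ := by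
  rw [SimpleGraph.reachable_iff_reflTransGen] at h
  induction h with
  | refl => exact ⟨ha, .rfl⟩
  | @tail b c _ hbc ih =>
    obtain ⟨hb, ih⟩ := ih
    exact ⟨hS b c hbc hb, ih.trans (SimpleGraph.Adj.reachable (by simpa using hbc))⟩

/-- A graph is acyclic if each of its vertices lies in a closed set on which it is acyclic. -/
lemma isAcyclic_of_induce {X : SimpleGraph V} (h : ∀ a b, X.Adj a b → ∃ S : Set V, a ∈ S ∧
    (∀ a b, X.Adj a b → a ∈ S → b ∈ S) ∧ (X.induce S).IsAcyclic) : X.IsAcyclic := by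
  rw [← indep_bot_iff_isAcyclic]
  intro u v huv hr
  obtain ⟨S, hu, hS, hac⟩ := h u v huv
  rw [sup_bot_eq] at hr
  obtain ⟨hv, hr⟩ := reachable_induce (X := X \ SimpleGraph.edge u v)
    (fun a b hab => hS a b hab.1) hu hr
  rw [← indep_bot_iff_isAcyclic] at hac
  refine hac ⟨u, hu⟩ ⟨v, hv⟩ (by simpa using huv) (hr.mono ?_)
  rintro ⟨a, ha⟩ ⟨b, hb⟩ hab
  simp only [SimpleGraph.comap_adj, Function.Embedding.subtype_apply, SimpleGraph.sdiff_adj,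
    SimpleGraph.edge_adj, SimpleGraph.sup_adj, Subtype.mk.injEq, ne_eq] at hab ⊢
  exact .inl hab

/-- Vertices outside `K` are isolated in `T`, so acyclicity may be tested on all of `V`. As `K` is
connected, joining the endpoints of its edges amounts to being connected on its vertices. -/
lemma spanningTrees_eq_bases {G : SimpleGraph V} {K : G.Subgraph} (hK : K.Connected) :
    spanningTrees K = bases ⊥ K.spanningCoe := by
  ext T
  simp only [spanningTrees, bases, Set.mem_ofPred_eq, sup_bot_eq, indep_bot_iff_isAcyclic]
  refine and_congr_right fun hT => ?_
  have hcl : ∀ a b, T.Adj a b → a ∈ K.verts → b ∈ K.verts :=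
    fun a b hab _ => K.edge_vert (hT hab).symm
  constructor
  · rintro ⟨hc, hac⟩
    refine ⟨fun a b hab => ?_, isAcyclic_of_induce fun a b hab =>
      ⟨K.verts, K.edge_vert (hT hab), hcl, hac⟩⟩
    have := (hc.preconnected ⟨a, K.edge_vert hab⟩ ⟨b, K.edge_vert hab.symm⟩).map
      (SimpleGraph.Embedding.induce K.verts).toHom
    exact this
  · rintro ⟨hs, hac⟩
    have : Nonempty K.verts := hK.nonempty.to_subtype
    refine ⟨⟨?_⟩, hac.comap (SimpleGraph.Embedding.induce K.verts).toHom Subtype.val_injective⟩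
    rintro ⟨a, ha⟩ ⟨b, hb⟩
    have h2 : K.spanningCoe.Reachable a b := by
      have := hK.preconnected ⟨a, ha⟩ ⟨b, hb⟩
      exact this.map (⟨fun v => v.1, fun {x y} h => h⟩ : K.coe →g K.spanningCoe)
    exact (reachable_induce hcl ha (reachable_of_adj_le hs h2)).2

/-- The graph whose components are the complement of `S` and the points of `S`. -/
def wiring (S : Set V) : SimpleGraph V where
  Adj a b := a ≠ b ∧ a ∉ S ∧ b ∉ S
  symm := ⟨fun _ _ h => ⟨h.1.symm, h.2.2, h.2.1⟩⟩
  loopless := ⟨fun _ h => h.1 rfl⟩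

/-- The edges of `G` with an endpoint in `S`. -/
def touching (G : SimpleGraph V) (S : Set V) : SimpleGraph V where
  Adj a b := G.Adj a b ∧ (a ∈ S ∨ b ∈ S)
  symm := ⟨fun _ _ h => ⟨h.1.symm, h.2.symm⟩⟩
  loopless := ⟨fun _ h => h.1.ne rfl⟩

lemma collapse_eq_iff {S : Set V} {a b : V} :
    collapse S a = collapse S b ↔ a = b ∨ (a ∉ S ∧ b ∉ S) := by
  unfold collapse
  split_ifs with h1 h2 h2
  · simp [h1]
  · simp [h1]; rintro rfl; exact h2 h1
  · simp [h1, h2]; rintro rfl; exact h1 h2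
  · simp [h1, h2]

lemma wiring_reachable_of_collapse_eq {S : Set V} {a b : V} (h : collapse S a = collapse S b) :
    (wiring S).Reachable a b := by
  rcases collapse_eq_iff.1 h with rfl | h'
  · exact .rfl
  · by_cases hab : a = b
    · exact hab ▸ .rfl
    · exact SimpleGraph.Adj.reachable ⟨hab, h'⟩

lemma collapse_surjective {S : Set V} (hS : Sᶜ.Nonempty) : Function.Surjective (collapse S) := by
  rintro (_ | ⟨v, hv⟩)
  · obtain ⟨w, hw⟩ := hS
    exact ⟨w, dif_neg hw⟩
  · exact ⟨v, dif_pos hv⟩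

lemma collapsed_adj {S : Set V} {T : SimpleGraph V} {p q : Option S} :
    (SimpleGraph.fromEdgeSet (Sym2.map (collapse S) '' T.edgeSet)).Adj p q ↔
      (∃ a b, T.Adj a b ∧ collapse S a = p ∧ collapse S b = q) ∧ p ≠ q := by
  rw [SimpleGraph.fromEdgeSet_adj]
  refine and_congr_left fun _ => ⟨?_, ?_⟩
  · rintro ⟨e, he, h⟩
    induction e with
    | _ a b =>
    rw [Sym2.map_mk, Sym2.eq_iff] at h
    rcases h with h | h
    exacts [⟨a, b, he, h⟩, ⟨b, a, SimpleGraph.Adj.symm he, h.2, h.1⟩]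
  · rintro ⟨a, b, hab, rfl, rfl⟩
    exact ⟨s(a, b), hab, rfl⟩

lemma collapsed_reachable {S : Set V} {T : SimpleGraph V} {a b : V} :
    (SimpleGraph.fromEdgeSet (Sym2.map (collapse S) '' T.edgeSet)).Reachable
      (collapse S a) (collapse S b) ↔ (T ⊔ wiring S).Reachable a b := by
  constructor
  · intro h
    generalize hp : collapse S a = p at h
    generalize hq : collapse S b = q at h
    rw [SimpleGraph.reachable_iff_reflTransGen] at h
    induction h generalizing b with
    | refl => exact (wiring_reachable_of_collapse_eq (hp.trans hq.symm)).mono le_sup_right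
    | tail _ hbc ih =>
      obtain ⟨⟨a', b', hab', rfl, rfl⟩, -⟩ := collapsed_adj.1 hbc
      exact ((ih rfl).trans (SimpleGraph.Adj.reachable (.inl hab'))).trans
        ((wiring_reachable_of_collapse_eq hq.symm).mono le_sup_right)
  · intro h
    rw [SimpleGraph.reachable_iff_reflTransGen] at h
    induction h with
    | refl => exact .rfl
    | @tail b c _ hbc ih =>
      refine ih.trans ?_
      rcases hbc with hbc | hbc
      · by_cases h : collapse S b = collapse S c
        · rw [h]
        · exact SimpleGraph.Adj.reachable (collapsed_adj.2 ⟨⟨b, c, hbc, rfl, rfl⟩, h⟩)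
      · rw [collapse_eq_iff.2 (.inr hbc.2)]

/-- Identifying the complement of `S` is contracting `wiring S`. Edges with both ends outside `S`
become loops, leaving those of `touching G S`. Independence over the wiring excludes loops, parallel
pairs and longer cycles together. A nonempty complement is needed for `none` to be the image of a
vertex. -/
lemma wiredSpanningTrees_eq_bases {G : SimpleGraph V} (hG : G.Connected) {S : Set V}
    (hS : Sᶜ.Nonempty) : wiredSpanningTrees G S = bases (wiring S) (touching G S) := by
  ext T
  constructor
  · rintro ⟨hTG, hdiag, hinj, hconn, hac⟩
    have hne : ∀ {a b}, T.Adj a b → collapse S a ≠ collapse S b := fun {a b} hab h =>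
      hdiag s(a, b) hab (by simpa using h)
    refine ⟨fun a b hab => ⟨hTG hab, ?_⟩, fun a b _ => ?_, fun u v huv hr => ?_⟩
    · by_contra! hcon
      exact hne hab (collapse_eq_iff.2 (.inr hcon))
    · exact collapsed_reachable.1 (hconn.preconnected _ _)
    · rw [← indep_bot_iff_isAcyclic] at hac
      refine hac _ _ (collapsed_adj.2 ⟨⟨u, v, huv, rfl, rfl⟩, hne huv⟩) ?_
      refine (collapsed_reachable.2 hr).mono (le_sup_of_le_left fun p q hpq => ?_)
      obtain ⟨⟨a, b, hab, rfl, rfl⟩, hpq⟩ := collapsed_adj.1 hpq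
      refine ⟨collapsed_adj.2 ⟨⟨a, b, hab.1, rfl, rfl⟩, hpq⟩, fun he => hab.2 ?_⟩
      have h1 : s(a, b) = s(u, v) := hinj hab.1 huv (by
        rw [SimpleGraph.edge_adj] at he
        simpa [Sym2.eq_iff] using he.1)
      rw [SimpleGraph.edge_adj]
      exact ⟨by simpa [Sym2.eq_iff] using h1, hab.1.ne⟩
  · rintro ⟨hTA, hsp, hind⟩
    have hne : ∀ {a b}, T.Adj a b → collapse S a ≠ collapse S b := fun {a b} hab h =>
      hind a b hab ((wiring_reachable_of_collapse_eq h).mono le_sup_right)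
    have hpar : ∀ {a b a' b'}, T.Adj a b → T.Adj a' b' → collapse S a = collapse S a' →
        collapse S b = collapse S b' → s(a, b) = s(a', b') := by
      intro a b a' b' hab hab' ha hb
      by_contra hcon
      have hr : (T \ SimpleGraph.edge a b ⊔ wiring S).Adj a' b' := by
        refine .inl ⟨hab', fun h => hcon ?_⟩
        rw [SimpleGraph.edge_adj] at h
        exact (Sym2.eq_iff.2 h.1).symm
      exact hind a b hab ((((wiring_reachable_of_collapse_eq ha).mono le_sup_right).trans
        hr.reachable).trans ((wiring_reachable_of_collapse_eq hb.symm).mono le_sup_right))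
    refine ⟨fun a b hab => (hTA hab).1, ?_, ?_, ⟨?_, ?_⟩⟩
    · intro e he
      induction e with
      | _ a b => simpa using hne he
    · intro e he e' he' h
      induction e with
      | _ a b =>
      induction e' with
      | _ a' b' =>
      simp only [Sym2.map_mk, Sym2.eq_iff] at h
      rcases h with h | h
      · exact hpar he he' h.1 h.2
      · rw [Sym2.eq_swap (a := a')]
        exact hpar he (SimpleGraph.Adj.symm he') h.1 h.2
    · have : Nonempty (Option S) := ⟨none⟩
      refine ⟨fun p q => ?_⟩
      obtain ⟨a, rfl⟩ := collapse_surjective hS p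
      obtain ⟨b, rfl⟩ := collapse_surjective hS q
      refine collapsed_reachable.2 (reachable_of_adj_le (fun u v huv => ?_) (hG.preconnected a b))
      by_cases h : u ∈ S ∨ v ∈ S
      · exact hsp u v ⟨huv, h⟩
      · push Not at h
        exact SimpleGraph.Adj.reachable (.inr ⟨huv.ne, h⟩)
    · rw [← indep_bot_iff_isAcyclic]
      intro p q hpq hr
      obtain ⟨⟨a, b, hab, rfl, rfl⟩, hpq⟩ := collapsed_adj.1 hpq
      refine hind a b hab (collapsed_reachable.1 (hr.mono (sup_le (fun p' q' h => ?_) bot_le)))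
      obtain ⟨⟨a', b', hab', rfl, rfl⟩, hpq'⟩ := collapsed_adj.1 h.1
      refine collapsed_adj.2 ⟨⟨a', b', ⟨hab', fun he => h.2 ?_⟩, rfl, rfl⟩, hpq'⟩
      rw [SimpleGraph.edge_adj] at he ⊢
      refine ⟨?_, hpq'⟩
      rcases he.1 with ⟨rfl, rfl⟩ | ⟨rfl, rfl⟩ <;> simp

/-! ### Laws of random subgraphs -/

/-- The event that all the edges in `s` are present. -/
def containing (s : Finset (Sym2 V)) : Set (SimpleGraph V) := {X | ↑s ⊆ X.edgeSet}

lemma measurableSet_mem_edgeSet (e : Sym2 V) : MeasurableSet {X : SimpleGraph V | e ∈ X.edgeSet} := by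
  induction e with
  | _ a b =>
    simp only [SimpleGraph.mem_edgeSet]
    exact measurableSet_setOfPred.2 (by fun_prop)

lemma containing_anti {s t : Finset (Sym2 V)} (h : s ⊆ t) : containing t ⊆ containing s :=
  fun _ hX => (Finset.coe_subset.2 h).trans hX

lemma measurableSet_containing (s : Finset (Sym2 V)) : MeasurableSet (containing s) := by
  have : containing s = ⋂ e ∈ s, {X : SimpleGraph V | e ∈ X.edgeSet} := by
    ext X
    simp [containing, Set.subset_def]
  rw [this]
  exact Finset.measurableSet_biInter _ fun e _ => measurableSet_mem_edgeSet e

/-- The events of containing finitely many edges form a generating π-system, so inclusion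
probabilities determine a law. This is why the estimates concern only such events. -/
lemma generateFrom_containing :
    (inferInstance : MeasurableSpace (SimpleGraph V)) =
      MeasurableSpace.generateFrom (Set.range containing) := by
  apply le_antisymm
  · have h : @Measurable (SimpleGraph V) (SimpleGraph V)
        (MeasurableSpace.generateFrom (Set.range containing)) inferInstance id := by
      rw [SimpleGraph.measurable_iff_adj]
      intro u v
      apply measurable_to_prop
      refine MeasurableSpace.measurableSet_generateFrom ⟨{s(u, v)}, ?_⟩
      ext X
      simp [containing]
    simpa using h.comap_le
  · refine MeasurableSpace.generateFrom_le ?_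
    rintro _ ⟨s, rfl⟩
    exact measurableSet_containing s

lemma isPiSystem_containing : IsPiSystem (Set.range (containing (V := V))) := by
  classical
  rintro _ ⟨s, rfl⟩ _ ⟨t, rfl⟩ -
  refine ⟨s ∪ t, ?_⟩
  ext X
  simp [containing]

lemma measurable_inf_right (H : SimpleGraph V) : Measurable fun X : SimpleGraph V => X ⊓ H := by
  rw [SimpleGraph.measurable_iff_adj]
  intro u v
  simp only [SimpleGraph.inf_adj]
  fun_prop

instance [Countable V] : MeasurableSingletonClass (SimpleGraph V) := by
  refine ⟨fun X => ?_⟩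
  have h : MeasurableSet ({X.edgeSet} : Set (Set (Sym2 V))) := MeasurableSet.singleton _
  convert SimpleGraph.measurable_edgeSet h
  ext Y
  simp

lemma measurableSet_inf_eq [Countable V] (H B : SimpleGraph V) :
    MeasurableSet {X : SimpleGraph V | X ⊓ H = B} :=
  measurable_inf_right H (MeasurableSet.singleton B)

open Classical in
lemma measure_inf_mem [Countable V] (μ : Measure (SimpleGraph V)) {Q : SimpleGraph V}
    (hQ : Q.edgeSet.Finite) (p : SimpleGraph V → Prop) :
    μ {T | p (T ⊓ Q)} = ∑ B ∈ (finite_setOf_le hQ).toFinset with p B, μ {T | T ⊓ Q = B} := by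
  have h : {T | p (T ⊓ Q)} = ⋃ B ∈ (finite_setOf_le hQ).toFinset.filter p,
      {T : SimpleGraph V | T ⊓ Q = B} := by
    ext T
    simp
  rw [h, measure_biUnion_finset]
  · intro B _ B' _ hne
    refine Set.disjoint_left.2 fun T hT hT' => hne ?_
    rw [← hT, ← hT']
  · exact fun B _ => measurableSet_inf_eq Q B

lemma measurableSet_inf_mem [Countable V] {Q : SimpleGraph V}
    (hQ : Q.edgeSet.Finite) (p : SimpleGraph V → Prop) : MeasurableSet {T | p (T ⊓ Q)} := by
  have h := measurable_inf_right Q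
    ((finite_setOf_le hQ).inter_of_left {T | p T}).measurableSet
  convert h using 1
  ext T
  simp

open Classical in
lemma uniformOn_apply_ncard [Countable V] {B : Set (SimpleGraph V)} (hB : B.Finite)
    (t : Set (SimpleGraph V)) : uniformOn B t = (B ∩ t).ncard / B.ncard := by
  have hBt : (B ∩ t).Finite := hB.subset Set.inter_subset_left
  rw [uniformOn, cond_apply hB.measurableSet, Measure.count_apply_finite _ hB,
    Measure.count_apply_finite _ hBt, ← Set.ncard_eq_toFinset_card _ hB,
    ← Set.ncard_eq_toFinset_card _ hBt, ENNReal.div_eq_inv_mul]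

lemma uniformOn_bases_containing [Countable V] {W A : SimpleGraph V} (hA : A.edgeSet.Finite)
    (s : Finset (Sym2 V)) : uniformOn (bases W A) (containing s) = basesProb W A s :=
  uniformOn_apply_ncard (finite_bases hA) _

lemma isProbabilityMeasure_uniformOn_bases [Countable V] {W A : SimpleGraph V}
    (hA : A.edgeSet.Finite) : IsProbabilityMeasure (uniformOn (bases W A)) :=
  isProbabilityMeasure_uniformOn (finite_bases hA) (bases_nonempty hA)

open Classical in
/-- Convergence of the probabilities of the presence of finitely many edges implies convergence
of the joint law of any finitely many edges. -/
lemma tendsto_containing_diff [Countable V] {ι : Type*} {l : Filter ι}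
    {ν : ι → Measure (SimpleGraph V)} [∀ i, IsProbabilityMeasure (ν i)]
    {μ : Measure (SimpleGraph V)} [IsProbabilityMeasure μ]
    (h : ∀ s, Tendsto (fun i => ν i (containing s)) l (𝓝 (μ (containing s))))
    (s R : Finset (Sym2 V)) :
    Tendsto (fun i => ν i (containing s ∩ {X | Disjoint ↑R X.edgeSet})) l
      (𝓝 (μ (containing s ∩ {X | Disjoint ↑R X.edgeSet}))) := by
  induction R using Finset.induction_on generalizing s with
  | empty => simpa using h s
  | insert r R hr ih =>
    -- Inclusion–exclusion one edge at a time: forbidding `r` subtracts the event where `r` is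
    -- required.
    have hset : containing s ∩ {X | Disjoint ↑(insert r R) X.edgeSet} =
        (containing s ∩ {X | Disjoint ↑R X.edgeSet}) \
          (containing (insert r s) ∩ {X | Disjoint ↑R X.edgeSet}) := by
      ext X
      simp only [containing, Set.mem_inter_iff, Set.mem_ofPred_eq, Finset.coe_insert,
        Set.disjoint_insert_left, Set.mem_sdiff, Set.insert_subset_iff]
      tauto
    have hsub : containing (insert r s) ∩ {X | Disjoint ↑R X.edgeSet} ⊆
        containing s ∩ {X | Disjoint ↑R X.edgeSet} := by
      exact Set.inter_subset_inter_left _ (containing_anti (Finset.subset_insert r s))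
    have hmeas : MeasurableSet (containing (insert r s) ∩ {X | Disjoint ↑R X.edgeSet}) := by
      refine (measurableSet_containing _).inter ?_
      have : {X : SimpleGraph V | Disjoint ↑R X.edgeSet} =
          ⋂ e ∈ R, {X : SimpleGraph V | e ∈ X.edgeSet}ᶜ := by
        ext X
        simp [Set.disjoint_left]
      rw [this]
      exact Finset.measurableSet_biInter _ fun e _ => (measurableSet_mem_edgeSet e).compl
    rw [hset]
    have hd : ∀ (m : Measure (SimpleGraph V)) [IsProbabilityMeasure m], m _ = _ := fun m _ =>
      measure_sdiff (μ := m) hsub hmeas.nullMeasurableSet (measure_ne_top m _)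
    simp_rw [hd]
    exact ENNReal.Tendsto.sub (ih s) (ih _) (.inl (measure_ne_top μ _))

lemma inf_eq_iff {H B T : SimpleGraph V} (hB : B ≤ H) :
    T ⊓ H = B ↔ B.edgeSet ⊆ T.edgeSet ∧ Disjoint (H \ B).edgeSet T.edgeSet := by
  rw [SimpleGraph.edgeSet_subset_edgeSet, SimpleGraph.disjoint_edgeSet]
  constructor
  · rintro rfl
    refine ⟨inf_le_left, ?_⟩
    rw [sdiff_inf_self_right]
    exact disjoint_sdiff_self_left
  · rintro ⟨h1, h2⟩
    refine le_antisymm ?_ (le_inf h1 hB)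
    have h3 : T ⊓ H ≤ H \ B ⊔ B := by
      rw [sdiff_sup_self]
      exact inf_le_right.trans le_sup_left
    have h4 : Disjoint (T ⊓ H) (H \ B) := h2.symm.mono_left inf_le_left
    exact h4.left_le_of_le_sup_left h3

lemma tendsto_inf_eq [Countable V] {ι : Type*} {l : Filter ι}
    {ν : ι → Measure (SimpleGraph V)} [∀ i, IsProbabilityMeasure (ν i)]
    {μ : Measure (SimpleGraph V)} [IsProbabilityMeasure μ]
    (h : ∀ s, Tendsto (fun i => ν i (containing s)) l (𝓝 (μ (containing s))))
    {H : SimpleGraph V} (hH : H.edgeSet.Finite) (B : SimpleGraph V) :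
    Tendsto (fun i => ν i {T | T ⊓ H = B}) l (𝓝 (μ {T | T ⊓ H = B})) := by
  by_cases hB : B ≤ H
  · have h1 := tendsto_containing_diff h (finite_edgeSet_of_le hH hB).toFinset
      (finite_edgeSet_of_le hH (sdiff_le : H \ B ≤ H)).toFinset
    have h2 : containing (finite_edgeSet_of_le hH hB).toFinset ∩
        {X | Disjoint ↑(finite_edgeSet_of_le hH (sdiff_le : H \ B ≤ H)).toFinset X.edgeSet} =
        {T | T ⊓ H = B} := by
      ext X
      simp only [Set.mem_ofPred_eq, inf_eq_iff hB, containing, Set.mem_inter_iff,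
        Set.Finite.coe_toFinset]
    rwa [h2] at h1
  · have h2 : {T : SimpleGraph V | T ⊓ H = B} = ∅ := by
      ext T
      simp only [Set.mem_ofPred_eq, Set.mem_empty_iff_false, iff_false]
      rintro rfl
      exact hB inf_le_right
    simpa [h2] using tendsto_const_nhds

/-- If the probabilities of the presence of finitely many edges converge, then the limits are
those of a random graph. -/
lemma exists_limit [Countable V] {ι : Type*} {l : Filter ι} [l.NeBot]
    (ν : ι → Measure (SimpleGraph V)) [∀ i, IsProbabilityMeasure (ν i)]
    {q : Finset (Sym2 V) → ℝ≥0∞}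
    (h : ∀ s, Tendsto (fun i => ν i (containing s)) l (𝓝 (q s))) :
    ∃ μ : Measure (SimpleGraph V), IsProbabilityMeasure μ ∧ ∀ s, μ (containing s) = q s := by
  classical
  set f : SimpleGraph V → (Sym2 V → Bool) := fun X e => decide (e ∈ X.edgeSet) with hf
  have hfm : Measurable f := by
    refine measurable_pi_iff.2 fun e => ?_
    refine measurable_to_bool ?_
    convert measurableSet_mem_edgeSet e
    ext X
    simp [hf]
  set g : (Sym2 V → Bool) → SimpleGraph V := fun x => SimpleGraph.fromEdgeSet {e | x e = true}
  have hgm : Measurable g := by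
    refine SimpleGraph.measurable_iff_adj.2 fun u v => ?_
    simp only [g, SimpleGraph.fromEdgeSet_adj, Set.mem_ofPred_eq]
    refine Measurable.and ?_ measurable_const
    exact measurableSet_setOfPred.1 (measurableSet_eq_fun (measurable_pi_apply s(u, v))
      measurable_const)
  -- Laws on the compact product space form a compact space, so an ultrafilter finer than `l` has a
  -- weak limit. Cylinder events are clopen, so their probabilities pass to it. The map `g` back to
  -- graphs discards the diagonal coordinates, which is why sets `s` with a diagonal element are
  -- treated apart.
  let ν' : ι → ProbabilityMeasure (Sym2 V → Bool) := fun i =>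
    ⟨(ν i).map f, Measure.isProbabilityMeasure_map hfm.aemeasurable⟩
  let U := Ultrafilter.of l
  have hlim : Tendsto ν' U (𝓝 (U.map ν').lim) := (U.map ν').le_nhds_lim
  set μ' := (U.map ν').lim
  refine ⟨(μ' : Measure _).map g, Measure.isProbabilityMeasure_map hgm.aemeasurable, fun s => ?_⟩
  rw [Measure.map_apply hgm (measurableSet_containing s)]
  have hU := (h s).mono_left (Ultrafilter.of_le l)
  by_cases hs : ∀ e ∈ s, ¬ e.IsDiag
  · have hpre : g ⁻¹' containing s = {x | ∀ e ∈ s, x e = true} := by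
      ext x
      simp only [g, containing, Set.mem_preimage, Set.mem_ofPred_eq, SimpleGraph.edgeSet_fromEdgeSet,
        Set.subset_def, Set.mem_sdiff, Finset.mem_coe]
      exact ⟨fun h e he => (h e he).1, fun h e he => ⟨h e he, hs e he⟩⟩
    have hclopen : IsClopen {x : Sym2 V → Bool | ∀ e ∈ s, x e = true} := by
      have : {x : Sym2 V → Bool | ∀ e ∈ s, x e = true} =
          ⋂ e ∈ s, (fun x : Sym2 V → Bool => x e) ⁻¹' {true} := by
        ext x; simp
      rw [this]
      exact isClopen_biInter_finset fun e _ =>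
        (isClopen_discrete _).preimage (continuous_apply e)
    have h1 := ProbabilityMeasure.tendsto_measure_of_null_frontier_of_tendsto' hlim
      (E := {x | ∀ e ∈ s, x e = true}) (by rw [hclopen.frontier_eq]; simp)
    rw [hpre]
    refine tendsto_nhds_unique h1 (hU.congr fun i => ?_)
    change _ = (ν i).map f _
    rw [Measure.map_apply hfm hclopen.isOpen.measurableSet]
    congr 1
    ext X
    simp [containing, hf, Set.subset_def]
  · have hemp : containing s = ∅ := by
      push Not at hs
      obtain ⟨e, he, hd⟩ := hs
      ext X
      simp only [Set.mem_empty_iff_false, iff_false]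
      exact fun hX => SimpleGraph.not_isDiag_of_mem_edgeSet _ (hX he) hd
    simp only [hemp, measure_empty, Set.preimage_empty] at hU ⊢
    exact tendsto_nhds_unique tendsto_const_nhds hU

lemma ae_le_of_containing [Countable V] {μ : Measure (SimpleGraph V)} {G : SimpleGraph V}
    (h : ∀ s : Finset (Sym2 V), ¬ ↑s ⊆ G.edgeSet → μ (containing s) = 0) : ∀ᵐ F ∂μ, F ≤ G := by
  have h1 : ∀ᵐ F ∂μ, ∀ e : Sym2 V, e ∉ G.edgeSet → e ∉ F.edgeSet := by
    rw [ae_all_iff]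
    intro e
    by_cases he : e ∈ G.edgeSet
    · exact .of_forall fun _ h => absurd he h
    · have := h {e} (by simpa using he)
      filter_upwards [measure_eq_zero_iff_ae_notMem.1 this] with F hF _ hF'
      exact hF (by simpa [containing] using hF')
  filter_upwards [h1] with F hF
  rw [← SimpleGraph.edgeSet_subset_edgeSet]
  exact fun e he => by_contra fun hc => hF e hc he

/-! ### Exhaustions -/

/-- Add the vertices one by one along an enumeration, each time enlarging the finite set to a
connected one. The subgraphs being induced, one exhaustion serves the free and the wired case. -/
lemma exists_isExhaustion [Countable V] {G : SimpleGraph V} (hG : G.Connected) :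
    ∃ K : ℕ → G.Subgraph, IsExhaustion G K ∧ ∀ n, (K n).IsInduced := by
  classical
  have := hG.nonempty
  obtain ⟨e, he⟩ := exists_surjective_nat V
  choose! ext hext using fun (t : Finset V) (ht : t.Nonempty) =>
    SimpleGraph.extend_finset_to_connected hG.preconnected ht
  obtain ⟨S, hS0, hS⟩ : ∃ S : ℕ → Finset V, S 0 = ext {e 0} ∧
      ∀ n, S (n + 1) = ext (insert (e (n + 1)) (S n)) :=
    ⟨fun n => n.rec (ext {e 0}) fun n T => ext (insert (e (n + 1)) T), rfl, fun _ => rfl⟩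
  have hmem : ∀ n, e n ∈ S n := by
    rintro (_ | n)
    · rw [hS0]; exact (hext {e 0} (by simp)).1 (by simp)
    · rw [hS]; exact (hext (insert (e (n + 1)) (S n)) (by simp)).1 (by simp)
  have hconn : ∀ n, (G.induce (↑(S n) : Set V)).Connected := by
    rintro (_ | n)
    · rw [hS0]; exact (hext {e 0} (by simp)).2
    · rw [hS]; exact (hext (insert (e (n + 1)) (S n)) (by simp)).2
  have hmono : Monotone S := monotone_nat_of_le_succ fun n => by
    rw [hS]
    exact (Finset.subset_insert _ _).trans (hext (insert (e (n + 1)) (S n)) (by simp)).1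
  refine ⟨fun n => (⊤ : G.Subgraph).induce (S n), ⟨?_, ?_, ?_, ?_⟩, ?_⟩
  · intro n; exact (S n).finite_toSet
  · intro n; exact SimpleGraph.connected_induce_iff.1 (hconn n)
  · intro m n hmn
    exact SimpleGraph.Subgraph.induce_mono_right (Finset.coe_subset.2 (hmono hmn))
  · ext a b
    · simp only [SimpleGraph.Subgraph.verts_iSup, SimpleGraph.Subgraph.induce_verts,
        Set.mem_iUnion, SimpleGraph.Subgraph.verts_top, Set.mem_univ, iff_true]
      obtain ⟨n, rfl⟩ := he a
      exact ⟨n, hmem n⟩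
    · simp only [SimpleGraph.Subgraph.iSup_adj, SimpleGraph.Subgraph.induce_adj,
        SimpleGraph.Subgraph.top_adj]
      refine ⟨fun ⟨_, h⟩ => h.2.2, fun h => ?_⟩
      obtain ⟨m, rfl⟩ := he a
      obtain ⟨n, rfl⟩ := he b
      exact ⟨max m n, hmono (le_max_left m n) (hmem m), hmono (le_max_right m n) (hmem n), h⟩
  · exact fun n => SimpleGraph.Subgraph.isInduced_iff_exists_eq_induce_top _ |>.2 ⟨_, rfl⟩

lemma IsExhaustion.eventually_mem {G : SimpleGraph V} {K : ℕ → G.Subgraph}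
    (hK : IsExhaustion G K) (v : V) : ∀ᶠ n in atTop, v ∈ (K n).verts := by
  have h : v ∈ (⨆ n, K n).verts := by rw [hK.iSup_eq]; trivial
  rw [SimpleGraph.Subgraph.verts_iSup, Set.mem_iUnion] at h
  obtain ⟨n, hn⟩ := h
  filter_upwards [eventually_ge_atTop n] with m hm
  exact (hK.mono hm).1 hn

lemma IsExhaustion.eventually_le {G : SimpleGraph V} {K : ℕ → G.Subgraph}
    (hK : IsExhaustion G K) {A : SimpleGraph V} (hA : A.edgeSet.Finite) (hAG : A ≤ G) :
    ∀ᶠ n in atTop, A ≤ (K n).spanningCoe := by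
  have h : ∀ᶠ n in atTop, ∀ e ∈ A.edgeSet, e ∈ (K n).spanningCoe.edgeSet := by
    refine (eventually_all_finite hA).2 fun e he => ?_
    induction e with
    | _ a b =>
    have h : (⨆ n, K n).Adj a b := by rw [hK.iSup_eq]; exact hAG he
    rw [SimpleGraph.Subgraph.iSup_adj] at h
    obtain ⟨n, hn⟩ := h
    filter_upwards [eventually_ge_atTop n] with m hm
    exact (hK.mono hm).2 hn
  filter_upwards [h] with n hn
  rw [← SimpleGraph.edgeSet_subset_edgeSet]
  exact hn

lemma IsExhaustion.finite_edgeSet {G : SimpleGraph V} {K : ℕ → G.Subgraph}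
    (hK : IsExhaustion G K) (n : ℕ) : (K n).spanningCoe.edgeSet.Finite := by
  refine ((hK.finite n).prod (hK.finite n)).image (fun d => s(d.1, d.2)) |>.subset ?_
  intro e he
  induction e with
  | _ a b =>
  exact ⟨(a, b), ⟨(K n).edge_vert he, (K n).edge_vert (SimpleGraph.Subgraph.Adj.symm he)⟩, rfl⟩

/-! ### Existence of the free spanning forest -/

open Classical in
/-- The limiting probability of the presence of the edges in `s` in the free spanning forest. -/
noncomputable def freeProb (G : SimpleGraph V) (s : Finset (Sym2 V)) : ℝ≥0∞ :=
  if ↑s ⊆ G.edgeSet then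
    ⨅ A : {A : SimpleGraph V // A ≤ G ∧ A.edgeSet.Finite ∧ ↑s ⊆ A.edgeSet}, basesProb ⊥ A.1 s
  else 0

/-- The inclusion probability decreases with the graph, so along any cofinal family it tends to the
infimum. This makes the limit independent of the exhaustion. -/
lemma tendsto_freeProb {ι : Type*} {l : Filter ι} {G : SimpleGraph V} {f : ι → SimpleGraph V}
    (hf : ∀ i, (f i).edgeSet.Finite) (hfG : ∀ i, f i ≤ G)
    (hev : ∀ A ≤ G, A.edgeSet.Finite → ∀ᶠ i in l, A ≤ f i) (s : Finset (Sym2 V)) :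
    Tendsto (fun i => basesProb ⊥ (f i) s) l (𝓝 (freeProb G s)) := by
  unfold freeProb
  split_ifs with hs
  · have hA₀ : (SimpleGraph.fromEdgeSet ↑s ⊓ G) ≤ G := inf_le_right
    have hA₀f : (SimpleGraph.fromEdgeSet ↑s ⊓ G).edgeSet.Finite := by
      refine s.finite_toSet.subset ?_
      rw [SimpleGraph.edgeSet_inf, SimpleGraph.edgeSet_fromEdgeSet]
      exact fun e he => he.1.1
    have hA₀s : ↑s ⊆ (SimpleGraph.fromEdgeSet ↑s ⊓ G).edgeSet := by
      rw [SimpleGraph.edgeSet_inf, SimpleGraph.edgeSet_fromEdgeSet]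
      exact fun e he => ⟨⟨he, SimpleGraph.not_isDiag_of_mem_edgeSet _ (hs he)⟩, hs he⟩
    refine tendsto_order.2 ⟨fun a ha => ?_, fun a ha => ?_⟩
    · filter_upwards [hev _ hA₀ hA₀f] with i hi
      exact ha.trans_le (iInf_le _ (⟨f i, hfG i, hf i,
        hA₀s.trans (SimpleGraph.edgeSet_mono hi)⟩ : {A : SimpleGraph V // _}))
    · obtain ⟨⟨A, hAG, hAf, hAs⟩, hlt⟩ := iInf_lt_iff.1 ha
      filter_upwards [hev A hAG hAf] with i hi
      exact (basesProb_anti (hf i) le_rfl hi hAs).trans_lt hlt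
  · refine tendsto_const_nhds.congr fun i => ?_
    rw [basesProb_eq_zero (basesWith_eq_empty_of_not_subset fun h =>
      hs (h.trans (SimpleGraph.edgeSet_mono (hfG i))))]

lemma ust_eq {G : SimpleGraph V} {K : ℕ → G.Subgraph} (hK : IsExhaustion G K) (n : ℕ) :
    ust (K n) = uniformOn (bases ⊥ (K n).spanningCoe) := by
  rw [ust, spanningTrees_eq_bases (hK.connected n)]

lemma isFSF_of_freeProb [Countable V] {G : SimpleGraph V} {μ : Measure (SimpleGraph V)}
    [IsProbabilityMeasure μ] (hμ : ∀ s, μ (containing s) = freeProb G s) : IsFSF G μ := by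
  refine ⟨inferInstance, ?_, ?_⟩
  · refine ae_le_of_containing fun s hs => ?_
    rw [hμ, freeProb, if_neg hs]
  · intro K hK H _ hH B
    simp_rw [ust_eq hK]
    have := fun n => isProbabilityMeasure_uniformOn_bases (W := ⊥) (hK.finite_edgeSet n)
    refine tendsto_inf_eq (fun s => ?_) hH B
    simp_rw [uniformOn_bases_containing (hK.finite_edgeSet _), hμ]
    exact tendsto_freeProb hK.finite_edgeSet (fun n => (K n).spanningCoe_le)
      (fun A hAG hA => hK.eventually_le hA hAG) s

/-- The limit is taken along all finite sets of edges, which requires no connectedness of `G`. -/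
lemma exists_isFSF [Countable V] (G : SimpleGraph V) : ∃ μ, IsFSF G μ := by
  classical
  set f : Finset (Sym2 V) → SimpleGraph V := fun F => SimpleGraph.fromEdgeSet ↑F ⊓ G
  have hf : ∀ F, (f F).edgeSet.Finite := fun F => by
    refine F.finite_toSet.subset ?_
    rw [SimpleGraph.edgeSet_inf, SimpleGraph.edgeSet_fromEdgeSet]
    exact fun e he => he.1.1
  have := fun F => isProbabilityMeasure_uniformOn_bases (W := ⊥) (hf F)
  obtain ⟨μ, hμ, h⟩ := exists_limit (l := atTop) (q := freeProb G)
    (fun F => uniformOn (bases ⊥ (f F))) (fun s => by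
      simp_rw [uniformOn_bases_containing (hf _)]
      refine tendsto_freeProb hf (fun F => inf_le_right) (fun A hAG hA => ?_) s
      filter_upwards [eventually_ge_atTop hA.toFinset] with F hF
      refine le_inf ?_ hAG
      rw [← SimpleGraph.edgeSet_subset_edgeSet, SimpleGraph.edgeSet_fromEdgeSet]
      exact fun e he => ⟨hF (by simpa using he), SimpleGraph.not_isDiag_of_mem_edgeSet _ he⟩)
  exact ⟨μ, isFSF_of_freeProb h⟩

lemma isFSF_fsf [Countable V] (G : SimpleGraph V) : IsFSF G (fsf G) := by
  rw [fsf, dif_pos (exists_isFSF G)]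
  exact (exists_isFSF G).choose_spec

/-! ### Limits of uniform bases -/

/-- `μ` is a limit of laws of uniform bases of graphs exhausting `G`. -/
structure IsBasesLimit (G : SimpleGraph V) (μ : Measure (SimpleGraph V)) : Prop where
  isProbabilityMeasure : IsProbabilityMeasure μ
  ae_le : ∀ᵐ F ∂μ, F ≤ G
  exists_tendsto : ∃ W A : ℕ → SimpleGraph V, (∀ n, (A n).edgeSet.Finite) ∧
    (∀ B ≤ G, B.edgeSet.Finite → ∀ᶠ n in atTop, B ≤ A n) ∧
    ∀ H ≤ G, H.edgeSet.Finite → ∀ B : SimpleGraph V,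
      Tendsto (fun n => uniformOn (bases (W n) (A n)) {T | T ⊓ H = B}) atTop
        (𝓝 (μ {F | F ⊓ H = B}))

lemma IsFSF.isBasesLimit [Countable V] {G : SimpleGraph V} (hG : G.Connected)
    {μ : Measure (SimpleGraph V)} (hμ : IsFSF G μ) : IsBasesLimit G μ := by
  obtain ⟨K, hK, -⟩ := exists_isExhaustion hG
  refine ⟨hμ.isProbabilityMeasure, hμ.ae_le, fun _ => ⊥, fun n => (K n).spanningCoe,
    hK.finite_edgeSet, fun B hB hBf => hK.eventually_le hBf hB, fun H hHG hH B => ?_⟩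
  simp_rw [← ust_eq hK]
  exact hμ.tendsto K hK H hHG hH B

lemma containing_eq_inf_eq {s : Finset (Sym2 V)} {G : SimpleGraph V} (hs : ↑s ⊆ G.edgeSet) :
    containing s = {T : SimpleGraph V | T ⊓ SimpleGraph.fromEdgeSet ↑s =
      SimpleGraph.fromEdgeSet ↑s} := by
  ext T
  rw [Set.mem_ofPred_eq, inf_eq_right, ← SimpleGraph.edgeSet_subset_edgeSet,
    SimpleGraph.edgeSet_fromEdgeSet]
  exact ⟨fun h e he => h he.1, fun h e he =>
    h ⟨he, SimpleGraph.not_isDiag_of_mem_edgeSet _ (hs he)⟩⟩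

lemma finite_fromEdgeSet (s : Finset (Sym2 V)) :
    (SimpleGraph.fromEdgeSet (s : Set (Sym2 V))).edgeSet.Finite :=
  s.finite_toSet.subset (by rw [SimpleGraph.edgeSet_fromEdgeSet]; exact Set.sdiff_subset)

/-- The free spanning forest contains given edges with the limiting probability along any
exhaustion. -/
lemma IsFSF.tendsto_containing [Countable V] {G : SimpleGraph V} {μ : Measure (SimpleGraph V)}
    (hμ : IsFSF G μ) {K : ℕ → G.Subgraph} (hK : IsExhaustion G K) {s : Finset (Sym2 V)}
    (hs : ↑s ⊆ G.edgeSet) :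
    Tendsto (fun n => basesProb ⊥ (K n).spanningCoe s) atTop (𝓝 (μ (containing s))) := by
  simp_rw [← uniformOn_bases_containing (hK.finite_edgeSet _), containing_eq_inf_eq hs, ← ust_eq hK]
  refine hμ.tendsto K hK _ ?_ (finite_fromEdgeSet s) _
  rw [← SimpleGraph.edgeSet_subset_edgeSet, SimpleGraph.edgeSet_fromEdgeSet]
  exact Set.sdiff_subset.trans hs

/-- A given finite edge set with a cycle is never contained in an approximating tree, so has
limiting probability zero. There are only countably many such sets. -/
lemma IsFSF.ae_isAcyclic [Countable V] {G : SimpleGraph V} (hG : G.Connected)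
    {μ : Measure (SimpleGraph V)} (hμ : IsFSF G μ) : ∀ᵐ T ∂μ, T.IsAcyclic := by
  obtain ⟨K, hK, -⟩ := exists_isExhaustion hG
  have h : ∀ᵐ T ∂μ, ∀ s : Finset (Sym2 V),
      ¬ (SimpleGraph.fromEdgeSet (s : Set (Sym2 V))).IsAcyclic → ¬ ↑s ⊆ T.edgeSet := by
    rw [ae_all_iff]
    intro s
    by_cases hac : (SimpleGraph.fromEdgeSet (s : Set (Sym2 V))).IsAcyclic
    · exact .of_forall fun _ h => absurd hac h
    by_cases hs : ↑s ⊆ G.edgeSet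
    · have h0 : μ (containing s) = 0 := by
        refine tendsto_nhds_unique (hμ.tendsto_containing hK hs) (tendsto_const_nhds.congr ?_)
        refine fun n => (basesProb_eq_zero ?_).symm
        ext X
        simp only [Set.mem_empty_iff_false, iff_false]
        rintro ⟨hX, hsX⟩
        refine hac (SimpleGraph.IsAcyclic.anti ?_ (indep_bot_iff_isAcyclic.1 hX.2.2))
        rw [← SimpleGraph.edgeSet_subset_edgeSet, SimpleGraph.edgeSet_fromEdgeSet]
        exact Set.sdiff_subset.trans hsX
      filter_upwards [measure_eq_zero_iff_ae_notMem.1 h0] with T hT _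
      exact hT
    · filter_upwards [hμ.ae_le] with T hT _ h'
      exact hs (h'.trans (SimpleGraph.edgeSet_mono hT))
  filter_upwards [h] with T hT v c hc
  classical
  refine hT c.edges.toFinset ?_ fun e he => c.edges_subset_edgeSet (by simpa using he)
  intro hac
  refine hac (c.transfer _ fun e he => ?_) (hc.transfer _)
  rw [SimpleGraph.edgeSet_fromEdgeSet]
  exact ⟨by simpa using he, SimpleGraph.not_isDiag_of_mem_edgeSet _ (c.edges_subset_edgeSet he)⟩

/-! ### Existence of the wired spanning forest -/

/-- The limiting probability of the presence of the edges in `s` in the wired spanning forest. -/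
noncomputable def wiredProb (G : SimpleGraph V) (s : Finset (Sym2 V)) : ℝ≥0∞ :=
  ⨆ U : Finset V, basesProb (wiring (U : Set V)) (touching G U) s

lemma finite_touching {G : SimpleGraph V} [G.LocallyFinite] {S : Set V} (hS : S.Finite) :
    (touching G S).edgeSet.Finite := by
  have h : (⋃ v ∈ S, (fun w => s(v, w)) '' G.neighborSet v).Finite :=
    hS.biUnion fun v _ => (Set.toFinite _).image _
  refine h.subset fun e he => ?_
  induction e with
  | _ a b =>
  simp only [Set.mem_iUnion]
  rcases he with ⟨hab, ha | hb⟩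
  · exact ⟨a, ha, b, hab, rfl⟩
  · exact ⟨b, hb, a, hab.symm, Sym2.eq_swap⟩

/-- The additional edges are loops over `W`: no base uses them, and they are spanned for free. -/
lemma bases_eq_of_loops {W A A' : SimpleGraph V} (hA : A ≤ A')
    (h : ∀ a b, A'.Adj a b → ¬ A.Adj a b → W.Reachable a b) : bases W A = bases W A' := by
  ext X
  constructor
  · rintro ⟨hX, hs, hi⟩
    refine ⟨hX.trans hA, fun a b hab => ?_, hi⟩
    by_cases hab' : A.Adj a b
    · exact hs a b hab'
    · exact (h a b hab hab').mono le_sup_right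
  · rintro ⟨hX, hs, hi⟩
    refine ⟨fun a b hab => ?_, fun a b hab => hs a b (hA hab), hi⟩
    by_contra hc
    exact hi a b hab ((h a b (hX hab) hc).mono le_sup_right)

/-- For `U ⊆ U'`, the edges touching only `U'` are loops over the wiring of `U`, so both wirings may
be compared on the same graph. The smaller wiring of `U'` then gives the larger probability. -/
lemma monotone_wired {G : SimpleGraph V} [G.LocallyFinite] (s : Finset (Sym2 V)) :
    Monotone fun U : Finset V => basesProb (wiring (U : Set V)) (touching G U) s := by
  intro U U' hU
  dsimp only
  have hle : touching G (U : Set V) ≤ touching G (U' : Set V) := fun a b h =>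
    ⟨h.1, h.2.imp (@hU a) (@hU b)⟩
  have hb : bases (wiring (U : Set V)) (touching G U) =
      bases (wiring (U : Set V)) (touching G U') := by
    refine bases_eq_of_loops hle fun a b hab h => SimpleGraph.Adj.reachable ⟨hab.1.ne, ?_⟩
    have h' : ¬ (a ∈ (U : Set V) ∨ b ∈ (U : Set V)) := fun h' => h ⟨hab.1, h'⟩
    push Not at h'
    exact h'
  have hp : basesProb (wiring (U : Set V)) (touching G U) s =
      basesProb (wiring (U : Set V)) (touching G U') s := by
    rw [basesProb, basesProb, basesWith, basesWith, hb]
  rw [hp]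
  by_cases hs : ↑s ⊆ (touching G (U' : Set V)).edgeSet
  · have hW : wiring (U' : Set V) ≤ wiring (U : Set V) := fun a b h =>
      ⟨h.1, fun h' => h.2.1 (hU h'), fun h' => h.2.2 (hU h')⟩
    exact basesProb_anti (finite_touching U'.finite_toSet) hW le_rfl hs
  · rw [basesProb_eq_zero (basesWith_eq_empty_of_not_subset hs)]
    exact zero_le

lemma touching_le (G : SimpleGraph V) (S : Set V) : touching G S ≤ G := fun _ _ h => h.1

lemma wiredProb_eq_zero {G : SimpleGraph V} {s : Finset (Sym2 V)} (hs : ¬ ↑s ⊆ G.edgeSet) :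
    wiredProb G s = 0 := by
  refine ENNReal.iSup_eq_zero.2 fun U => ?_
  exact basesProb_eq_zero (basesWith_eq_empty_of_not_subset fun h =>
    hs (h.trans (SimpleGraph.edgeSet_mono (touching_le G _))))

lemma wiredUst_eq [Infinite V] {G : SimpleGraph V} (hG : G.Connected) {S : Set V}
    (hS : S.Finite) : wiredUst G S = uniformOn (bases (wiring S) (touching G S)) := by
  rw [wiredUst, wiredSpanningTrees_eq_bases hG hS.infinite_compl.nonempty]

lemma exists_isWSF [Countable V] [Infinite V] {G : SimpleGraph V} [G.LocallyFinite]
    (hG : G.Connected) : ∃ μ, IsWSF G μ := by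
  classical
  have := fun U : Finset V => isProbabilityMeasure_uniformOn_bases (W := wiring (U : Set V))
    (finite_touching (G := G) U.finite_toSet)
  obtain ⟨μ, hμ, h⟩ := exists_limit (l := atTop) (q := wiredProb G)
    (fun U : Finset V => uniformOn (bases (wiring (U : Set V)) (touching G U))) (fun s => by
      simp_rw [uniformOn_bases_containing (finite_touching (Finset.finite_toSet _))]
      exact tendsto_atTop_iSup (monotone_wired s))
  refine ⟨μ, hμ, ae_le_of_containing fun s hs => by rw [h, wiredProb_eq_zero hs], ?_⟩
  intro K hK _ H _ hH B
  simp_rw [wiredUst_eq hG (hK.finite _)]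
  have := fun n => isProbabilityMeasure_uniformOn_bases (W := wiring (K n).verts)
    (finite_touching (G := G) (hK.finite n))
  refine tendsto_inf_eq (fun s => ?_) hH B
  simp_rw [uniformOn_bases_containing (finite_touching (hK.finite _)), h]
  have hU : Tendsto (fun n => (hK.finite n).toFinset) atTop atTop := by
    refine tendsto_atTop.2 fun U => ?_
    have : ∀ᶠ n in atTop, ∀ v ∈ U, v ∈ (K n).verts :=
      (Filter.eventually_all_finset U).2 fun v _ => hK.eventually_mem v
    filter_upwards [this] with n hn v hv
    simpa using hn v hv
  have := (tendsto_atTop_iSup (monotone_wired (G := G) s)).comp hU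
  refine this.congr fun n => ?_
  simp

lemma isWSF_wsf [Countable V] [Infinite V] {G : SimpleGraph V} [G.LocallyFinite]
    (hG : G.Connected) : IsWSF G (wsf G) := by
  rw [wsf, dif_pos (exists_isWSF hG)]
  exact (exists_isWSF hG).choose_spec

lemma IsWSF.isBasesLimit [Countable V] [Infinite V] {G : SimpleGraph V} [G.LocallyFinite]
    (hG : G.Connected) {μ : Measure (SimpleGraph V)} (hμ : IsWSF G μ) : IsBasesLimit G μ := by
  obtain ⟨K, hK, hKi⟩ := exists_isExhaustion hG
  refine ⟨hμ.isProbabilityMeasure, hμ.ae_le, fun n => wiring (K n).verts,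
    fun n => touching G (K n).verts, fun n => finite_touching (hK.finite n),
    fun B hB hBf => ?_, fun H hHG hH B => ?_⟩
  · filter_upwards [hK.eventually_le hBf hB] with n hn a b hab
    exact ⟨hB hab, .inl ((K n).edge_vert (hn hab))⟩
  · simp_rw [← wiredUst_eq hG (hK.finite _)]
    exact hμ.tendsto K hK hKi H hHG hH B

/-! ### Finite windows -/

/-- An increasing sequence of finite graphs containing every finite graph eventually. -/
structure IsWindow (Q : ℕ → SimpleGraph V) : Prop where
  mono : Monotone Q
  finite : ∀ n, (Q n).edgeSet.Finite
  eventually_le : ∀ H : SimpleGraph V, H.edgeSet.Finite → ∀ᶠ n in atTop, H ≤ Q n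

lemma exists_isWindow (V : Type u) [Countable V] : ∃ Q : ℕ → SimpleGraph V, IsWindow Q := by
  obtain ⟨f, hf⟩ := exists_injective_nat (Sym2 V)
  have hfin : ∀ n, {e | f e ≤ n}.Finite := fun n =>
    (Set.finite_Iic n).preimage hf.injOn
  refine ⟨fun n => SimpleGraph.fromEdgeSet {e | f e ≤ n}, ?_, fun n => ?_, fun H hH => ?_⟩
  · exact fun m n hmn => SimpleGraph.fromEdgeSet_mono fun e (he : f e ≤ m) => he.trans hmn
  · refine (hfin n).subset ?_
    rw [SimpleGraph.edgeSet_fromEdgeSet]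
    exact Set.sdiff_subset
  · have h : ∀ᶠ n in atTop, ∀ e ∈ H.edgeSet, f e ≤ n :=
      (eventually_all_finite hH).2 fun e _ => eventually_ge_atTop (f e)
    filter_upwards [h] with n hn
    rw [← SimpleGraph.edgeSet_subset_edgeSet, SimpleGraph.edgeSet_fromEdgeSet]
    exact fun e he => ⟨hn e he, SimpleGraph.not_isDiag_of_mem_edgeSet _ he⟩

lemma IsWindow.eventually_adj {Q : ℕ → SimpleGraph V} (hQ : IsWindow Q) {a b : V} (hab : a ≠ b) :
    ∀ᶠ n in atTop, (Q n).Adj a b := by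
  have hf : (SimpleGraph.edge a b).edgeSet.Finite :=
    (Set.finite_singleton s(a, b)).subset SimpleGraph.edgeSet_edge_subset
  filter_upwards [hQ.eventually_le _ hf] with n hn
  exact hn (by simp [SimpleGraph.edge_adj, hab])

lemma IsWindow.eventually_subset {Q : ℕ → SimpleGraph V} (hQ : IsWindow Q) {G : SimpleGraph V}
    {s : Finset (Sym2 V)} (hs : ↑s ⊆ G.edgeSet) : ∀ᶠ n in atTop, ↑s ⊆ (Q n).edgeSet := by
  filter_upwards [hQ.eventually_le _ (finite_fromEdgeSet s)] with n hn
  refine subset_trans ?_ (SimpleGraph.edgeSet_mono hn)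
  rw [SimpleGraph.edgeSet_fromEdgeSet]
  exact fun e he => ⟨he, SimpleGraph.not_isDiag_of_mem_edgeSet _ (hs he)⟩

lemma IsWindow.eventually_reachable {Q : ℕ → SimpleGraph V} (hQ : IsWindow Q) {F : SimpleGraph V}
    {a b : V} (h : F.Reachable a b) : ∀ᶠ n in atTop, (F ⊓ Q n).Reachable a b := by
  rw [SimpleGraph.reachable_iff_reflTransGen] at h
  induction h with
  | refl => exact .of_forall fun _ => .rfl
  | tail _ hbc ih =>
    filter_upwards [ih, hQ.eventually_adj hbc.ne] with n hn hn'
    exact hn.trans (SimpleGraph.Adj.reachable ⟨hbc, hn'⟩)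

/-! ### The induced-component graph -/

lemma inducedComponentGraph_le (G F : SimpleGraph V) : inducedComponentGraph G F ≤ G :=
  fun _ _ h => h.1

lemma le_inducedComponentGraph {G F : SimpleGraph V} (h : F ≤ G) :
    F ≤ inducedComponentGraph G F := fun _ _ hab => ⟨h hab, hab.reachable⟩

lemma measurableSet_reachable [Countable V] (a b : V) :
    MeasurableSet {F : SimpleGraph V | F.Reachable a b} := by
  obtain ⟨Q, hQ⟩ := exists_isWindow V
  have h : {F : SimpleGraph V | F.Reachable a b} = ⋃ n, {F | (F ⊓ Q n).Reachable a b} := by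
    ext F
    simp only [Set.mem_ofPred_eq, Set.mem_iUnion]
    exact ⟨fun h => (hQ.eventually_reachable h).exists, fun ⟨n, h⟩ => h.mono inf_le_left⟩
  rw [h]
  exact MeasurableSet.iUnion fun n => measurableSet_inf_mem (hQ.finite n) fun X => X.Reachable a b

lemma measurable_inducedComponentGraph [Countable V] (G : SimpleGraph V) :
    Measurable (inducedComponentGraph G) := by
  refine SimpleGraph.measurable_iff_adj.2 fun u v => ?_
  exact measurable_const.and (measurableSet_setOfPred.1 (measurableSet_reachable u v))

/-- Each of the finitely many edges of the induced-component graph in `H` is witnessed by one finite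
path of `F`, which a large window contains. -/
lemma IsWindow.eventually_inducedComponentGraph {Q : ℕ → SimpleGraph V} (hQ : IsWindow Q)
    {G F H : SimpleGraph V} (hF : F ≤ G) (hH : H.edgeSet.Finite) :
    ∀ᶠ n in atTop, inducedComponentGraph G (F ⊓ (Q n ⊓ G)) ⊓ H =
      inducedComponentGraph G F ⊓ H := by
  have h : ∀ᶠ n in atTop, ∀ e ∈ (inducedComponentGraph G F ⊓ H).edgeSet,
      e ∈ (inducedComponentGraph G (F ⊓ Q n)).edgeSet := by
    refine (eventually_all_finite (finite_edgeSet_of_le hH inf_le_right)).2 fun e he => ?_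
    induction e with
    | _ a b =>
    have he' : (inducedComponentGraph G F ⊓ H).Adj a b := he
    filter_upwards [hQ.eventually_reachable he'.1.2] with n hn
    exact ⟨he'.1.1, hn⟩
  filter_upwards [h] with n hn
  have hinf : F ⊓ (Q n ⊓ G) = F ⊓ Q n := by
    rw [inf_comm (Q n), ← inf_assoc, inf_eq_left.2 hF]
  rw [hinf]
  refine le_antisymm (inf_le_inf_right _ fun a b hab => ⟨hab.1, hab.2.mono inf_le_left⟩)
    (le_inf ?_ inf_le_right)
  rw [← SimpleGraph.edgeSet_subset_edgeSet]
  exact hn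

/-! ### Domination given the induced-component graph -/

section Domination

variable [Countable V] {G : SimpleGraph V} {μ : Measure (SimpleGraph V)}

lemma IsBasesLimit.tendsto_inf_mem (hμ : IsBasesLimit G μ) : ∃ W A : ℕ → SimpleGraph V,
    (∀ n, (A n).edgeSet.Finite) ∧ (∀ B ≤ G, B.edgeSet.Finite → ∀ᶠ n in atTop, B ≤ A n) ∧
    ∀ H ≤ G, H.edgeSet.Finite → ∀ p : SimpleGraph V → Prop,
      Tendsto (fun n => uniformOn (bases (W n) (A n)) {T | p (T ⊓ H)}) atTop
        (𝓝 (μ {F | p (F ⊓ H)})) := by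
  obtain ⟨W, A, hA, hev, ht⟩ := hμ.exists_tendsto
  refine ⟨W, A, hA, hev, fun H hHG hH p => ?_⟩
  simp_rw [measure_inf_mem _ hH p]
  exact tendsto_finsetSum _ fun B _ => ht H hHG hH B

/-- Both events depend only on the edges in `Q`, as `s ⊆ A ≤ Q`, so the inequality for finite graphs
passes to the limit. -/
lemma IsBasesLimit.measure_le_mul_of_finite (hμ : IsBasesLimit G μ) {Q A : SimpleGraph V}
    (hQ : Q.edgeSet.Finite) (hQG : Q ≤ G) (hAQ : A ≤ Q) {s : Finset (Sym2 V)}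
    (hs : ↑s ⊆ A.edgeSet) {p : SimpleGraph V → Prop}
    (hp : ∀ X Y : SimpleGraph V, X.Reachable = Y.Reachable → p X → p Y)
    (hpA : ∀ X, p X → A.Adj ≤ X.Reachable) :
    μ (containing s ∩ {F | p (F ⊓ Q)}) ≤ basesProb ⊥ A s * μ {F | p (F ⊓ Q)} := by
  obtain ⟨W, A₀, hA₀, hev, ht⟩ := hμ.tendsto_inf_mem
  have hset : containing s ∩ {F | p (F ⊓ Q)} =
      {F : SimpleGraph V | ↑s ⊆ (F ⊓ Q).edgeSet ∧ p (F ⊓ Q)} := by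
    ext F
    simp only [containing, Set.mem_inter_iff, Set.mem_ofPred_eq, SimpleGraph.edgeSet_inf,
      Set.subset_inter_iff, hs.trans (SimpleGraph.edgeSet_mono hAQ), and_true]
  have hAf := finite_edgeSet_of_le hQ hAQ
  have h1 := ht Q hQG hQ fun X => ↑s ⊆ X.edgeSet ∧ p X
  rw [← hset] at h1
  refine le_of_tendsto_of_tendsto h1 (ENNReal.Tendsto.const_mul (ht Q hQG hQ p)
    (.inr ((basesProb_le_one hAf s).trans_lt ENNReal.one_lt_top).ne)) ?_
  filter_upwards [hev A (hAQ.trans hQG) hAf] with n hn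
  rw [uniformOn_apply_ncard (finite_bases (hA₀ n)), uniformOn_apply_ncard (finite_bases (hA₀ n)),
    ← mul_div_assoc]
  refine ENNReal.div_le_div_right ?_ _
  have e1 : bases (W n) (A₀ n) ∩ (containing s ∩ {F | p (F ⊓ Q)}) =
      {T ∈ basesWith (W n) (A₀ n) s | p (T ⊓ Q)} := by
    ext X
    simp only [basesWith, containing, Set.mem_inter_iff, Set.mem_ofPred_eq, and_assoc]
  have e2 : bases (W n) (A₀ n) ∩ {F | p (F ⊓ Q)} = {T ∈ bases (W n) (A₀ n) | p (T ⊓ Q)} := rfl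
  rw [e1, e2]
  exact ncard_basesWith_le_mul (hA₀ n) hn hAQ hs hp hpA

/-- The event on the induced-component graph is not local, but is the limit of the events where
connectivity is tested inside a window `R n`. These depend on connectivity there alone and force the
edges of `D` to join connected vertices. Apart from this, `s` must lie in `D` and `D` in `G ⊓ Q`, or
the left side vanishes. -/
lemma IsBasesLimit.measure_le_mul (hμ : IsBasesLimit G μ) {Q D : SimpleGraph V}
    (hQ : Q.edgeSet.Finite) {s : Finset (Sym2 V)} (hs : ↑s ⊆ Q.edgeSet) :
    μ (containing s ∩ {F | inducedComponentGraph G F ⊓ Q = D}) ≤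
      basesProb ⊥ D s * μ {F | inducedComponentGraph G F ⊓ Q = D} := by
  have := hμ.isProbabilityMeasure
  by_cases hsD : ↑s ⊆ D.edgeSet
  swap
  · refine le_of_eq_of_le ?_ zero_le
    refine measure_eq_zero_iff_ae_notMem.2 ?_
    filter_upwards [hμ.ae_le] with F hF
    rintro ⟨h1, rfl⟩
    rw [SimpleGraph.edgeSet_inf] at hsD
    exact hsD (Set.subset_inter
      (subset_trans h1 (SimpleGraph.edgeSet_mono (le_inducedComponentGraph hF))) hs)
  by_cases hDG : D ≤ G ⊓ Q
  swap
  · have : {F | inducedComponentGraph G F ⊓ Q = D} = ∅ := by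
      ext F
      simp only [Set.mem_ofPred_eq, Set.mem_empty_iff_false, iff_false]
      rintro rfl
      exact hDG (inf_le_inf_right _ (inducedComponentGraph_le G F))
    simp [this]
  obtain ⟨R, hR⟩ := exists_isWindow V
  have hDf : D.edgeSet.Finite := finite_edgeSet_of_le hQ (hDG.trans inf_le_right)
  have hRf : ∀ n, (R n ⊓ G).edgeSet.Finite := fun n => finite_edgeSet_of_le (hR.finite n) inf_le_left
  let p : SimpleGraph V → Prop := fun X => inducedComponentGraph G X ⊓ Q = D
  have hmeas : MeasurableSet {F | p F} := by
    have := measurable_inducedComponentGraph G (measurableSet_inf_eq Q D)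
    exact this
  have hae : ∀ᵐ F ∂μ, ∀ᶠ n in atTop, p (F ⊓ (R n ⊓ G)) ↔ p F := by
    filter_upwards [hμ.ae_le] with F hF
    filter_upwards [hR.eventually_inducedComponentGraph hF hQ] with n hn
    simp only [p, hn]
  have hmeas' : ∀ n, MeasurableSet {F | p (F ⊓ (R n ⊓ G))} := fun n =>
    measurableSet_inf_mem (hRf n) p
  have h1 : Tendsto (fun n => μ {F | p (F ⊓ (R n ⊓ G))}) atTop (𝓝 (μ {F | p F})) :=
    tendsto_measure_of_ae_tendsto_indicator_of_isFiniteMeasure atTop hmeas hmeas' hae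
  have h2 : Tendsto (fun n => μ (containing s ∩ {F | p (F ⊓ (R n ⊓ G))})) atTop
      (𝓝 (μ (containing s ∩ {F | p F}))) := by
    refine tendsto_measure_of_ae_tendsto_indicator_of_isFiniteMeasure atTop
      ((measurableSet_containing s).inter hmeas)
      (fun n => (measurableSet_containing s).inter (hmeas' n)) ?_
    filter_upwards [hae] with F hF
    filter_upwards [hF] with n hn
    exact and_congr_right fun _ => hn
  refine le_of_tendsto_of_tendsto h2 (ENNReal.Tendsto.const_mul h1
    (.inr ((basesProb_le_one hDf s).trans_lt ENNReal.one_lt_top).ne)) ?_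
  filter_upwards [hR.eventually_le D hDf] with n hn
  refine hμ.measure_le_mul_of_finite (hRf n) inf_le_right
    (le_inf hn (hDG.trans inf_le_left)) hsD ?_ ?_
  · intro X Y hXY hX
    have : inducedComponentGraph G X = inducedComponentGraph G Y := by
      ext a b
      simp only [inducedComponentGraph, hXY]
    simpa only [p, ← this] using hX
  · intro X hX a b hab
    have hX' : inducedComponentGraph G X ⊓ Q = D := hX
    rw [← hX'] at hab
    exact hab.1.2

end Domination

/-! ### Minimal connecting sets of edges -/

/-- The minimal sets of edges containing `B` and connecting the endpoints of each edge of `D`,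
among those which contain no edge of `D` except those of `B`. -/
def links (B D : SimpleGraph V) : Set (Finset (Sym2 V)) :=
  {L | Minimal (fun L : Finset (Sym2 V) => B.edgeSet ⊆ ↑L ∧
    D.Adj ≤ (SimpleGraph.fromEdgeSet (L : Set (Sym2 V))).Reachable) L ∧
    SimpleGraph.fromEdgeSet ↑L ⊓ D = B}

lemma fromEdgeSet_le {s : Set (Sym2 V)} {T : SimpleGraph V} (h : s ⊆ T.edgeSet) :
    SimpleGraph.fromEdgeSet s ≤ T := by
  rw [← SimpleGraph.edgeSet_subset_edgeSet, SimpleGraph.edgeSet_fromEdgeSet]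
  exact Set.sdiff_subset.trans h

/-- Finitely many edges of `D` are connected already by a finite part of `F`. A minimal subset of
its edges that still does so and retains `F ⊓ D` is a link. -/
lemma exists_mem_links [Countable V] {F D : SimpleGraph V} (hD : D.edgeSet.Finite)
    (h : D.Adj ≤ F.Reachable) : ∃ L ∈ links (F ⊓ D) D, ↑L ⊆ F.edgeSet := by
  obtain ⟨Q, hQ⟩ := exists_isWindow V
  have h1 : ∀ᶠ n in atTop, ∀ e ∈ D.edgeSet, e ∈ (inducedComponentGraph D (F ⊓ Q n)).edgeSet := by
    refine (eventually_all_finite hD).2 fun e he => ?_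
    induction e with
    | _ a b =>
    filter_upwards [hQ.eventually_reachable (h a b he)] with n hn
    exact ⟨he, hn⟩
  obtain ⟨n, hn, hn'⟩ := (h1.and (hQ.eventually_le _ hD)).exists
  have hf : (F ⊓ Q n).edgeSet.Finite := finite_edgeSet_of_le (hQ.finite n) inf_le_right
  obtain ⟨L, hL, hmin⟩ := exists_minimal_le_of_wellFoundedLT
    (fun L : Finset (Sym2 V) => (F ⊓ D).edgeSet ⊆ ↑L ∧
      D.Adj ≤ (SimpleGraph.fromEdgeSet (L : Set (Sym2 V))).Reachable) hf.toFinset ⟨by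
        rw [Set.Finite.coe_toFinset]
        exact SimpleGraph.edgeSet_mono (inf_le_inf_left _ hn'), fun a b hab => by
        rw [Set.Finite.coe_toFinset, SimpleGraph.fromEdgeSet_edgeSet]
        exact (hn s(a, b) hab).2⟩
  have hLF : ↑L ⊆ F.edgeSet := by
    refine subset_trans (Finset.coe_subset.2 hL) ?_
    rw [Set.Finite.coe_toFinset]
    exact SimpleGraph.edgeSet_mono inf_le_left
  refine ⟨L, ⟨hmin, le_antisymm (inf_le_inf_right _ (fromEdgeSet_le hLF)) (le_inf ?_ inf_le_right)⟩,
    hLF⟩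
  rw [← SimpleGraph.edgeSet_subset_edgeSet, SimpleGraph.edgeSet_fromEdgeSet]
  exact fun e he => ⟨hmin.1.1 he, SimpleGraph.not_isDiag_of_mem_edgeSet _ he⟩

/-- In an acyclic graph, vertices connected inside two subgraphs are connected inside the
intersection. -/
lemma IsAcyclic.reachable_inf {T X Y : SimpleGraph V} (hT : T.IsAcyclic) (hX : X ≤ T) (hY : Y ≤ T)
    {a b : V} (ha : X.Reachable a b) (hb : Y.Reachable a b) : (X ⊓ Y).Reachable a b := by
  obtain ⟨p, hp⟩ := ha.exists_isPath
  obtain ⟨q, hq⟩ := hb.exists_isPath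
  have := hT.subsingleton_path a b
  have hpq : p.mapLe hX = q.mapLe hY := congrArg Subtype.val (Subsingleton.elim
    (⟨p.mapLe hX, hp.mapLe hX⟩ : T.Path a b) ⟨q.mapLe hY, hq.mapLe hY⟩)
  have hedges : p.edges = q.edges := by
    have := congrArg SimpleGraph.Walk.edges hpq
    simpa using this
  refine ⟨p.transfer _ fun e he => ?_⟩
  rw [SimpleGraph.edgeSet_inf]
  exact ⟨p.edges_subset_edgeSet he, q.edges_subset_edgeSet (hedges ▸ he)⟩

/-- Paths in a forest are unique, so the intersection of two links still connects the endpoints of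
the edges of `D`. Minimality then makes both equal to it. -/
lemma eq_of_mem_links {T B D : SimpleGraph V} (hT : T.IsAcyclic) {L L' : Finset (Sym2 V)}
    (hL : L ∈ links B D) (hL' : L' ∈ links B D) (hLT : ↑L ⊆ T.edgeSet) (hLT' : ↑L' ⊆ T.edgeSet) :
    L = L' := by
  classical
  have h : B.edgeSet ⊆ ↑(L ∩ L') ∧
      D.Adj ≤ (SimpleGraph.fromEdgeSet (↑(L ∩ L') : Set (Sym2 V))).Reachable := by
    rw [Finset.coe_inter]
    refine ⟨Set.subset_inter hL.1.1.1 hL'.1.1.1, fun a b hab => ?_⟩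
    rw [SimpleGraph.fromEdgeSet_inter]
    exact IsAcyclic.reachable_inf hT (fromEdgeSet_le hLT) (fromEdgeSet_le hLT')
      (hL.1.1.2 a b hab) (hL'.1.1.2 a b hab)
  have h1 := hL.1.2 h Finset.inter_subset_left
  have h2 := hL'.1.2 h Finset.inter_subset_right
  exact (h1.trans Finset.inter_subset_right).antisymm (h2.trans Finset.inter_subset_left)

/-- An edge of `T ⊓ D` is the only path in `T` between its endpoints, which `L` connects, so it
belongs to `L`. -/
lemma inf_eq_of_mem_links {T B D : SimpleGraph V} (hT : T.IsAcyclic) {L : Finset (Sym2 V)}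
    (hL : L ∈ links B D) (hLT : ↑L ⊆ T.edgeSet) : T ⊓ D = B := by
  refine le_antisymm (fun a b hab => ?_) ?_
  · have h1 := IsAcyclic.reachable_inf hT (fromEdgeSet_le hLT) (Y := SimpleGraph.edge a b)
      ((SimpleGraph.edge_le_iff _).2 (.inr hab.1)) (hL.1.1.2 a b hab.2)
      (SimpleGraph.Adj.reachable (by simp [SimpleGraph.edge_adj, hab.1.ne]))
    rw [← hL.2]
    refine ⟨?_, hab.2⟩
    by_contra hcon
    have h2 : SimpleGraph.fromEdgeSet ↑L ⊓ SimpleGraph.edge a b = ⊥ := by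
      rw [← disjoint_iff, SimpleGraph.disjoint_edge]
      exact hcon
    rw [h2, SimpleGraph.reachable_bot] at h1
    exact hab.1.ne h1
  · rw [← hL.2]
    exact inf_le_inf_right _ (fromEdgeSet_le hLT)

/-! ### Resampling given the induced-component graph -/

lemma containing_eq_empty {s : Finset (Sym2 V)} (hs : ¬ ↑s ⊆ (⊤ : SimpleGraph V).edgeSet) :
    containing s = ∅ := by
  ext X
  simp only [Set.mem_empty_iff_false, iff_false]
  exact fun hX => hs (subset_trans hX (SimpleGraph.edgeSet_mono le_top))

/-- The limiting probability that a uniform spanning forest of `H ⊓ Q n` contains `L`. -/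
noncomputable def windowProb (Q : ℕ → SimpleGraph V) (L : Finset (Sym2 V)) (H : SimpleGraph V) :
    ℝ≥0∞ := limsup (fun n => basesProb ⊥ (H ⊓ Q n) L) atTop

open Classical in
/-- The probability that the restriction of a random forest to `Q k` is `B`, computed through the
sets of edges linking the endpoints of the edges of `H ⊓ Q k`. -/
noncomputable def linkedProb (Q : ℕ → SimpleGraph V) (k : ℕ) (B H : SimpleGraph V) : ℝ≥0∞ :=
  ∑' L : Finset (Sym2 V), if L ∈ links B (H ⊓ Q k) then windowProb Q L H else 0

/-- The event that some set of edges in `links B D` is present. -/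
def linkedSet (B D : SimpleGraph V) : Set (SimpleGraph V) :=
  ⋃ L ∈ links B D, containing L

/-- This turns one-sided domination into equality: termwise inequalities between finite sums of
equal total are equalities. -/
lemma finset_eq_of_sum_le {ι : Type*} {I : Finset ι} {f g : ι → ℝ≥0∞} (hfg : ∀ i ∈ I, f i ≤ g i)
    (h : ∑ i ∈ I, g i ≤ ∑ i ∈ I, f i) (htop : ∑ i ∈ I, g i ≠ ∞) {i : ι} (hi : i ∈ I) :
    f i = g i := by
  classical
  refine (hfg i hi).antisymm ?_
  rw [← Finset.add_sum_erase _ _ hi, ← Finset.add_sum_erase _ f hi] at h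
  rw [← Finset.add_sum_erase _ _ hi] at htop
  have h1 : g i + ∑ x ∈ I.erase i, g x ≤ f i + ∑ x ∈ I.erase i, g x :=
    h.trans (add_le_add le_rfl (Finset.sum_le_sum fun j hj => hfg j (Finset.mem_of_mem_erase hj)))
  exact (ENNReal.add_le_add_iff_right (ENNReal.add_ne_top.1 htop).2).1 h1

lemma linkedSet_ae_le {Q : ℕ → SimpleGraph V} {κ : Measure (SimpleGraph V)} {H : SimpleGraph V}
    (hle : ∀ᵐ T ∂κ, T ≤ H) (hac : ∀ᵐ T ∂κ, T.IsAcyclic) (k : ℕ) (B : SimpleGraph V) :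
    linkedSet B (H ⊓ Q k) ≤ᵐ[κ] {T | T ⊓ Q k = B} := by
  filter_upwards [hle, hac] with T hTH hT hTL
  obtain ⟨L, hL, hLT⟩ := Set.mem_iUnion₂.1 (show T ∈ linkedSet B (H ⊓ Q k) from hTL)
  change T ⊓ Q k = B
  rw [← inf_eq_of_mem_links hT hL hLT, ← inf_assoc, inf_eq_left.2 hTH]

section

variable [Countable V]

open Classical in
lemma setLIntegral_inf_mem (P : Measure (SimpleGraph V)) {Q : SimpleGraph V}
    (hQ : Q.edgeSet.Finite) (p : SimpleGraph V → Prop) (f : SimpleGraph V → ℝ≥0∞) :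
    ∫⁻ H in {H | p (H ⊓ Q)}, f H ∂P =
      ∑ B ∈ (finite_setOf_le hQ).toFinset with p B, ∫⁻ H in {H | H ⊓ Q = B}, f H ∂P := by
  have h : {H | p (H ⊓ Q)} = ⋃ B ∈ (finite_setOf_le hQ).toFinset.filter p,
      {T : SimpleGraph V | T ⊓ Q = B} := by
    ext T
    simp
  rw [h, lintegral_biUnion_finset]
  · intro B _ B' _ hne
    refine Set.disjoint_left.2 fun T hT hT' => hne ?_
    rw [← hT, ← hT']
  · exact fun B _ => measurableSet_inf_eq Q B

lemma lintegral_inf (P : Measure (SimpleGraph V)) {Q : SimpleGraph V}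
    (hQ : Q.edgeSet.Finite) (f : SimpleGraph V → ℝ≥0∞) :
    ∫⁻ H, f H ∂P =
      ∑ B ∈ (finite_setOf_le hQ).toFinset, ∫⁻ H in {H | H ⊓ Q = B}, f H ∂P := by
  simpa using setLIntegral_inf_mem P hQ (fun _ => True) f

lemma sum_measure_inf_eq (P : Measure (SimpleGraph V)) [IsProbabilityMeasure P]
    {Q : SimpleGraph V} (hQ : Q.edgeSet.Finite) :
    ∑ B ∈ (finite_setOf_le hQ).toFinset, P {T | T ⊓ Q = B} = 1 := by
  have := measure_inf_mem P hQ fun _ => True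
  simpa using this.symm

variable {G : SimpleGraph V} {μ : Measure (SimpleGraph V)} {Q : ℕ → SimpleGraph V}

lemma measurable_windowProb (hQ : IsWindow Q) (L : Finset (Sym2 V)) :
    Measurable (windowProb Q L) := by
  refine Measurable.limsup fun n => ?_
  intro t _
  exact measurableSet_inf_mem (hQ.finite n) fun X => basesProb ⊥ X L ∈ t

lemma measurable_linkedProb (hQ : IsWindow Q) (k : ℕ) (B : SimpleGraph V) :
    Measurable (linkedProb Q k B) := by
  classical
  refine Measurable.tsum fun L => ?_
  exact Measurable.ite (measurableSet_inf_mem (hQ.finite k) fun X => L ∈ links B X)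
    (measurable_windowProb hQ L) measurable_const

open Classical in
-- The event is split according to the induced-component graph in a larger window `Q n`, the
-- domination is applied to each piece, and then `n` tends to infinity.
lemma IsBasesLimit.measure_le_setLIntegral (hμ : IsBasesLimit G μ) (hQ : IsWindow Q) (k : ℕ)
    (D : SimpleGraph V) (s : Finset (Sym2 V)) :
    μ (containing s ∩ {F | inducedComponentGraph G F ⊓ Q k = D}) ≤
      ∫⁻ H in {H | H ⊓ Q k = D}, windowProb Q s H ∂(μ.map (inducedComponentGraph G)) := by
  have := hμ.isProbabilityMeasure
  have hbar := measurable_inducedComponentGraph G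
  have hP : IsProbabilityMeasure (μ.map (inducedComponentGraph G)) :=
    Measure.isProbabilityMeasure_map hbar.aemeasurable
  set P := μ.map (inducedComponentGraph G) with hPdef
  by_cases hs : ↑s ⊆ (⊤ : SimpleGraph V).edgeSet
  swap
  · simp [containing_eq_empty hs]
  have hev : ∀ᶠ n in atTop, μ (containing s ∩ {F | inducedComponentGraph G F ⊓ Q k = D}) ≤
      ∫⁻ H in {H | H ⊓ Q k = D}, basesProb ⊥ (H ⊓ Q n) s ∂P := by
    filter_upwards [eventually_ge_atTop k, hQ.eventually_subset hs] with n hkn hsn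
    have hinf : ∀ H : SimpleGraph V, H ⊓ Q n ⊓ Q k = H ⊓ Q k := fun H => by
      rw [inf_assoc, inf_eq_right.2 (hQ.mono hkn)]
    have h1 := setLIntegral_inf_mem P (hQ.finite n) (fun X => X ⊓ Q k = D)
      fun H => basesProb ⊥ (H ⊓ Q n) s
    simp only [hinf] at h1
    rw [h1]
    have h2 : containing s ∩ {F | inducedComponentGraph G F ⊓ Q k = D} ⊆
        ⋃ B ∈ (finite_setOf_le (hQ.finite n)).toFinset.filter (fun X => X ⊓ Q k = D),
          containing s ∩ {F | inducedComponentGraph G F ⊓ Q n = B} := by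
      rintro F ⟨hF, hF'⟩
      simp only [Set.mem_iUnion]
      refine ⟨inducedComponentGraph G F ⊓ Q n, ?_, hF, rfl⟩
      simp only [Finset.mem_filter, Set.Finite.mem_toFinset, Set.mem_ofPred_eq, hinf]
      exact ⟨inf_le_right, hF'⟩
    refine (measure_mono h2).trans ((measure_biUnion_finset_le _ _).trans
      (Finset.sum_le_sum fun B _ => ?_))
    refine (hμ.measure_le_mul (hQ.finite n) hsn).trans (le_of_eq ?_)
    rw [setLIntegral_congr_fun (g := fun _ => basesProb ⊥ B s) (measurableSet_inf_eq _ _)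
      fun H (hH : H ⊓ Q n = B) => by simp only [hH], setLIntegral_const, hPdef,
      Measure.map_apply hbar (measurableSet_inf_eq _ _)]
    rfl
  calc μ (containing s ∩ {F | inducedComponentGraph G F ⊓ Q k = D})
      = limsup (fun _ : ℕ => μ (containing s ∩ {F | inducedComponentGraph G F ⊓ Q k = D})) atTop :=
        limsup_const _ |>.symm
    _ ≤ limsup (fun n => ∫⁻ H in {H | H ⊓ Q k = D}, basesProb ⊥ (H ⊓ Q n) s ∂P) atTop :=
        limsup_le_limsup hev
    _ ≤ ∫⁻ H in {H | H ⊓ Q k = D}, windowProb Q s H ∂P := by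
        -- Reverse Fatou, with the constant 1 as dominating function.
        refine limsup_lintegral_le (fun _ => 1) (fun n t _ => ?_) (fun n => ?_) ?_
        · exact measurableSet_inf_mem (hQ.finite n) fun X => basesProb ⊥ X s ∈ t
        · exact .of_forall fun H => basesProb_le_one
            (finite_edgeSet_of_le (hQ.finite n) inf_le_right) s
        · simp

/-- `F` connects the endpoints of every edge of its induced-component graph, so it contains some
link. The bound is a union bound over the traces `D` and their links. -/
lemma IsBasesLimit.measure_le_lintegral (hμ : IsBasesLimit G μ) (hQ : IsWindow Q) (k : ℕ)
    (B : SimpleGraph V) :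
    μ {F | F ⊓ Q k = B} ≤ ∫⁻ H, linkedProb Q k B H ∂(μ.map (inducedComponentGraph G)) := by
  classical
  set P := μ.map (inducedComponentGraph G) with hPdef
  rw [lintegral_inf P (hQ.finite k)]
  have h1 : μ {F | F ⊓ Q k = B} ≤ μ (⋃ D ∈ (finite_setOf_le (hQ.finite k)).toFinset,
      ⋃ L ∈ links B D, containing L ∩ {F | inducedComponentGraph G F ⊓ Q k = D}) := by
    refine measure_mono_ae ?_
    filter_upwards [hμ.ae_le] with F hFG hFB
    have hFB' : F ⊓ Q k = B := hFB
    set D := inducedComponentGraph G F ⊓ Q k with hD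
    have hFD : F ⊓ D = B := by
      rw [hD, ← inf_assoc, inf_eq_left.2 (le_inducedComponentGraph hFG), hFB']
    obtain ⟨L, hL, hLF⟩ := exists_mem_links (F := F) (D := D)
      (finite_edgeSet_of_le (hQ.finite k) inf_le_right) fun a b hab => hab.1.2
    rw [hFD] at hL
    refine Set.mem_biUnion (x := D) (by simp [hD]) (Set.mem_biUnion hL ⟨hLF, hD.symm⟩)
  refine h1.trans ((measure_biUnion_finset_le _ _).trans (Finset.sum_le_sum fun D _ => ?_))
  refine (measure_biUnion_le μ (Set.to_countable _) _).trans ?_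
  have h2 : ∫⁻ H in {H | H ⊓ Q k = D}, linkedProb Q k B H ∂P =
      ∑' L : Finset (Sym2 V), ∫⁻ H in {H | H ⊓ Q k = D},
        (if L ∈ links B D then windowProb Q L H else 0) ∂P := by
    rw [setLIntegral_congr_fun (g := fun H => ∑' L : Finset (Sym2 V),
      if L ∈ links B D then windowProb Q L H else 0) (measurableSet_inf_eq _ _)
      fun H (hH : H ⊓ Q k = D) => by simp only [linkedProb, hH]]
    refine lintegral_tsum fun L => ?_
    split_ifs
    exacts [(measurable_windowProb hQ L).aemeasurable, aemeasurable_const]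
  rw [h2, tsum_subtype (links B D)
    (fun L => μ (containing L ∩ {F | inducedComponentGraph G F ⊓ Q k = D}))]
  refine ENNReal.tsum_le_tsum fun L => ?_
  by_cases hL : L ∈ links B D
  · simp only [Set.indicator_of_mem hL, if_pos hL]
    exact hμ.measure_le_setLIntegral hQ k D L
  · simp [hL]

/-- A forest contains at most one link, so the events are almost surely disjoint and their
probabilities add up to that of the union. -/
lemma linkedProb_le {κ : Measure (SimpleGraph V)} {H : SimpleGraph V}
    (hac : ∀ᵐ T ∂κ, T.IsAcyclic) (hκ : ∀ L, windowProb Q L H ≤ κ (containing L)) (k : ℕ)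
    (B : SimpleGraph V) : linkedProb Q k B H ≤ κ (linkedSet B (H ⊓ Q k)) := by
  classical
  set S : Finset (Sym2 V) → Set (SimpleGraph V) := fun L =>
    if L ∈ links B (H ⊓ Q k) then containing L else ∅ with hS
  have hU : linkedSet B (H ⊓ Q k) = ⋃ L, S L := by
    ext T
    simp [linkedSet, hS]
  rw [hU, measure_iUnion₀]
  · refine ENNReal.tsum_le_tsum fun L => ?_
    simp only [hS]
    split_ifs
    exacts [hκ L, zero_le]
  · intro L L' hne
    refine measure_eq_zero_iff_ae_notMem.2 ?_
    filter_upwards [hac] with T hT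
    rintro ⟨h1, h2⟩
    simp only [hS] at h1 h2
    split_ifs at h1 with hL
    · split_ifs at h2 with hL'
      · exact hne (eq_of_mem_links hT hL hL' h1 h2)
      · exact h2
    · exact h1
  · intro L
    refine MeasurableSet.nullMeasurableSet ?_
    simp only [hS]
    split_ifs
    exacts [measurableSet_containing L, MeasurableSet.empty]

lemma measurableSet_linkedSet (B D : SimpleGraph V) : MeasurableSet (linkedSet B D) :=
  MeasurableSet.biUnion (Set.to_countable _) fun L _ => measurableSet_containing L

/-- Let `F` be a limit of uniform bases of graphs exhausting `G`. If `κ H` is a random forest in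
`H` which contains each finite set of edges with at least the limiting probability, then
resampling according to `κ` given the induced-component graph of `F` preserves the law of `F`,
and the resampled forest almost surely connects what `F` connects. -/
theorem IsBasesLimit.resample (hμ : IsBasesLimit G μ) (hQ : IsWindow Q)
    (κ : SimpleGraph V → Measure (SimpleGraph V)) [∀ H, IsProbabilityMeasure (κ H)]
    (hle : ∀ H, ∀ᵐ T ∂κ H, T ≤ H) (hac : ∀ H, ∀ᵐ T ∂κ H, T.IsAcyclic)
    (hκ : ∀ H L, windowProb Q L H ≤ κ H (containing L)) :
    (μ.map (inducedComponentGraph G)).bind κ = μ ∧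
    ∀ᵐ H ∂(μ.map (inducedComponentGraph G)), ∀ᵐ T ∂κ H, H.Adj ≤ T.Reachable := by
  classical
  have := hμ.isProbabilityMeasure
  have hbar := measurable_inducedComponentGraph G
  have hP : IsProbabilityMeasure (μ.map (inducedComponentGraph G)) :=
    Measure.isProbabilityMeasure_map hbar.aemeasurable
  have hge := hμ.measure_le_lintegral hQ
  set P := μ.map (inducedComponentGraph G) with hPdef
  set I : ℕ → Finset (SimpleGraph V) := fun k => (finite_setOf_le (hQ.finite k)).toFinset with hI
  have hlink : ∀ H k B, linkedProb Q k B H ≤ κ H (linkedSet B (H ⊓ Q k)) := fun H =>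
    linkedProb_le (hac H) (hκ H)
  have hlinkset : ∀ H k B, κ H (linkedSet B (H ⊓ Q k)) ≤ κ H {T | T ⊓ Q k = B} := fun H k B =>
    measure_mono_ae (linkedSet_ae_le (hle H) (hac H) k B)
  have hsum_le : ∀ k H, ∑ B ∈ I k, linkedProb Q k B H ≤ 1 := fun k H => by
    rw [← sum_measure_inf_eq (κ H) (hQ.finite k)]
    exact Finset.sum_le_sum fun B _ => (hlink H k B).trans (hlinkset H k B)
  have hint : ∀ k, ∑ B ∈ I k, ∫⁻ H, linkedProb Q k B H ∂P =
      ∫⁻ H, ∑ B ∈ I k, linkedProb Q k B H ∂P := fun k =>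
    (lintegral_finsetSum _ fun B _ => measurable_linkedProb hQ k B).symm
  have hint_le : ∀ k, ∑ B ∈ I k, ∫⁻ H, linkedProb Q k B H ∂P ≤ 1 := fun k => by
    rw [hint]
    refine (lintegral_mono (hsum_le k)).trans ?_
    simp
  -- Termwise the left side is at most the right, while over `B` the left sides sum to 1 and the
  -- right sides to at most 1.
  have hint_eq : ∀ k, ∀ B ∈ I k, μ {F | F ⊓ Q k = B} = ∫⁻ H, linkedProb Q k B H ∂P := by
    intro k B hB
    refine finset_eq_of_sum_le (fun B _ => hge k B) ?_
      ((hint_le k).trans_lt ENNReal.one_lt_top).ne hB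
    rw [sum_measure_inf_eq μ (hQ.finite k)]
    exact hint_le k
  have hae_sum : ∀ᵐ H ∂P, ∀ k, ∑ B ∈ I k, linkedProb Q k B H = 1 := by
    refine ae_all_iff.2 fun k => ?_
    refine ae_eq_of_ae_le_of_lintegral_le (.of_forall (hsum_le k))
      (by rw [← hint]; exact ((hint_le k).trans_lt ENNReal.one_lt_top).ne) aemeasurable_const ?_
    rw [← hint, ← Finset.sum_congr rfl (hint_eq k), sum_measure_inf_eq μ (hQ.finite k)]
    simp
  have hae : ∀ᵐ H ∂P, ∀ k, ∀ B ∈ I k, linkedProb Q k B H = κ H {T | T ⊓ Q k = B} := by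
    filter_upwards [hae_sum] with H hH k B hB
    refine finset_eq_of_sum_le (fun B _ => (hlink H k B).trans (hlinkset H k B)) ?_ ?_ hB
    · rw [hH, sum_measure_inf_eq (κ H) (hQ.finite k)]
    · rw [sum_measure_inf_eq (κ H) (hQ.finite k)]
      exact ENNReal.one_ne_top
  have hcyl : ∀ (m : Measure (SimpleGraph V)) {s : Finset (Sym2 V)} {k : ℕ},
      ↑s ⊆ (Q k).edgeSet → m (containing s) =
        ∑ B ∈ I k with ↑s ⊆ B.edgeSet, m {T | T ⊓ Q k = B} := by
    intro m s k hs
    rw [← measure_inf_mem m (hQ.finite k) fun X => ↑s ⊆ X.edgeSet]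
    congr 1
    ext T
    simp [containing, hs]
  -- Measurability of `κ` is not assumed. Off a null set its values on the π-system are finite sums
  -- of the measurable `linkedProb`, and on the null set it is replaced by a point mass.
  have hmeas : AEMeasurable κ P := by
    obtain ⟨t, ht, htm, ht0⟩ := exists_measurable_superset_of_null (ae_iff.1 hae)
    have hgood : ∀ H, H ∉ t → ∀ k, ∀ B ∈ I k, linkedProb Q k B H = κ H {T | T ⊓ Q k = B} :=
      fun H hH => by_contra fun hcon => hH (ht hcon)
    refine ⟨fun H => if H ∈ t then Measure.dirac ⊥ else κ H, ?_, ?_⟩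
    · have : ∀ H, IsProbabilityMeasure (if H ∈ t then Measure.dirac ⊥ else κ H) := fun H => by
        split_ifs <;> infer_instance
      refine Measurable.measure_of_isPiSystem_of_isProbabilityMeasure generateFrom_containing
        isPiSystem_containing ?_
      rintro _ ⟨s, rfl⟩
      by_cases hs : ↑s ⊆ (⊤ : SimpleGraph V).edgeSet
      · obtain ⟨k, hk⟩ := (hQ.eventually_subset hs).exists
        have : (fun H => (if H ∈ t then Measure.dirac ⊥ else κ H) (containing s)) = fun H =>
            if H ∈ t then (Measure.dirac ⊥ : Measure (SimpleGraph V)) (containing s) else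
              ∑ B ∈ I k with ↑s ⊆ B.edgeSet, linkedProb Q k B H := by
          ext H
          split_ifs with hH
          · rfl
          · rw [hcyl _ hk]
            exact Finset.sum_congr rfl fun B hB =>
              (hgood H hH k B (Finset.mem_filter.1 hB).1).symm
        rw [this]
        exact Measurable.ite htm measurable_const
          (Finset.measurable_fun_sum _ fun B _ => measurable_linkedProb hQ k B)
      · simp [containing_eq_empty hs]
    · filter_upwards [measure_eq_zero_iff_ae_notMem.1 ht0] with H hH
      rw [if_neg hH]
  refine ⟨?_, ?_⟩
  · have hbind : ∀ t, MeasurableSet t → P.bind κ t = ∫⁻ H, κ H t ∂P := fun t ht =>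
      Measure.bind_apply ht hmeas
    have huniv : P.bind κ Set.univ = 1 := by
      rw [hbind _ MeasurableSet.univ]
      simp
    have : IsFiniteMeasure (P.bind κ) := ⟨by rw [huniv]; exact ENNReal.one_lt_top⟩
    refine ext_of_generate_finite _ generateFrom_containing isPiSystem_containing ?_
      (by rw [huniv, measure_univ])
    rintro _ ⟨s, rfl⟩
    by_cases hs : ↑s ⊆ (⊤ : SimpleGraph V).edgeSet
    · obtain ⟨k, hk⟩ := (hQ.eventually_subset hs).exists
      rw [hbind _ (measurableSet_containing s), hcyl μ hk]
      have : ∫⁻ H, κ H (containing s) ∂P =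
          ∫⁻ H, ∑ B ∈ I k with ↑s ⊆ B.edgeSet, linkedProb Q k B H ∂P := by
        refine lintegral_congr_ae ?_
        filter_upwards [hae] with H hH
        rw [hcyl _ hk]
        exact Finset.sum_congr rfl fun B hB => (hH k B (Finset.mem_filter.1 hB).1).symm
      rw [this, lintegral_finsetSum _ fun B _ => measurable_linkedProb hQ k B]
      exact Finset.sum_congr rfl fun B hB => (hint_eq k B (Finset.mem_filter.1 hB).1).symm
    · simp [containing_eq_empty hs]
  · filter_upwards [hae] with H hH
    -- The linked event lies almost surely inside the cylinder and has the same measure, so almost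
    -- every `T` contains a link for its own trace on each window.
    have h1 : ∀ᵐ T ∂κ H, ∀ k, ∀ B ∈ I k, T ⊓ Q k = B → T ∈ linkedSet B (H ⊓ Q k) := by
      refine ae_all_iff.2 fun k => ?_
      refine (Filter.eventually_all_finset (I k)).2 fun B hB => ?_
      have h2 := ae_eq_of_ae_subset_of_measure_ge (linkedSet_ae_le (hle H) (hac H) k B)
        ((hH k B hB).symm.le.trans (hlink H k B))
        (measurableSet_linkedSet _ _).nullMeasurableSet (measure_ne_top _ _)
      filter_upwards [h2.symm.le] with T hT hTB
      exact hT hTB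
    filter_upwards [h1] with T hT a b hab
    obtain ⟨k, hk⟩ := (hQ.eventually_adj hab.ne).exists
    obtain ⟨L, hL, hLT⟩ := Set.mem_iUnion₂.1 (hT k (T ⊓ Q k) (by simp [hI]) rfl)
    exact (hL.1.1.2 a b ⟨hab, hk⟩).mono (fromEdgeSet_le hLT)

end

/-! ### Free spanning forests on the components of a graph -/

lemma reachable_of_spanningCoe {S : Set V} {X : SimpleGraph S} {a b : S}
    (h : X.spanningCoe.Reachable a b) : X.Reachable a b := by
  have hcl : ∀ u v, X.spanningCoe.Adj u v → u ∈ S → v ∈ S := by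
    intro u v huv _
    rw [SimpleGraph.map_adj] at huv
    obtain ⟨_, b, _, _, rfl⟩ := huv
    exact b.2
  obtain ⟨_, h⟩ := reachable_induce hcl a.2 h
  rwa [SimpleGraph.induce_spanningCoe] at h

lemma isAcyclic_spanningCoe {S : Set V} {X : SimpleGraph S} (h : X.IsAcyclic) :
    X.spanningCoe.IsAcyclic := by
  refine isAcyclic_of_induce fun u v huv => ?_
  have hcl : ∀ u v, X.spanningCoe.Adj u v → u ∈ S ∧ v ∈ S := by
    intro u v huv
    rw [SimpleGraph.map_adj] at huv
    obtain ⟨a, b, _, rfl, rfl⟩ := huv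
    exact ⟨a.2, b.2⟩
  exact ⟨S, (hcl u v huv).1, fun u v h _ => (hcl u v h).2, by
    rwa [SimpleGraph.induce_spanningCoe]⟩

lemma mem_edgeSet_spanningCoe {S : Set V} {X : SimpleGraph S} {e : Sym2 S} :
    e.map (↑) ∈ X.spanningCoe.edgeSet ↔ e ∈ X.edgeSet := by
  induction e with
  | _ a b =>
  rw [Sym2.map_mk, SimpleGraph.mem_edgeSet, SimpleGraph.mem_edgeSet]
  exact SimpleGraph.map_adj_apply (f := Function.Embedding.subtype _)

lemma bases_spanningCoe {S : Set V} (A : SimpleGraph S) :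
    bases ⊥ A.spanningCoe = SimpleGraph.spanningCoe '' bases ⊥ A := by
  have hadj : ∀ {X : SimpleGraph S} {a b : S}, X.spanningCoe.Adj a b ↔ X.Adj a b := fun {X a b} =>
    SimpleGraph.map_adj_apply (f := Function.Embedding.subtype _)
  ext Y
  simp only [bases, Set.mem_ofPred_eq, sup_bot_eq, indep_bot_iff_isAcyclic, Set.mem_image]
  constructor
  · rintro ⟨hYA, hs, hac⟩
    have hY : (Y.induce S).spanningCoe = Y := by
      rw [SimpleGraph.spanningCoe_induce_eq_self]
      rintro v ⟨w, hvw⟩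
      have h := hYA hvw
      rw [SimpleGraph.map_adj] at h
      obtain ⟨a, _, _, rfl, _⟩ := h
      exact a.2
    refine ⟨Y.induce S, ⟨fun a b hab => hadj.1 (hYA hab), fun a b hab => ?_, ?_⟩, hY⟩
    · refine reachable_of_spanningCoe ?_
      rw [hY]
      exact hs _ _ (hadj.2 hab)
    · exact SimpleGraph.IsAcyclic.of_map (Function.Embedding.subtype _) (by rw [← hY] at hac; exact hac)
  · rintro ⟨X, ⟨hXA, hs, hac⟩, rfl⟩
    refine ⟨SimpleGraph.map_monotone _ hXA, fun u v huv => ?_, isAcyclic_spanningCoe hac⟩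
    rw [SimpleGraph.map_adj] at huv
    obtain ⟨a, b, hab, rfl, rfl⟩ := huv
    exact (hs a b hab).map (SimpleGraph.Embedding.map (Function.Embedding.subtype _) X).toHom

lemma basesProb_spanningCoe {S : Set V} (A : SimpleGraph S) (L : Finset (Sym2 S)) :
    basesProb ⊥ A.spanningCoe (L.map (Function.Embedding.subtype (· ∈ S)).sym2Map) =
      basesProb ⊥ A L := by
  have hinj : Function.Injective (SimpleGraph.spanningCoe (s := S)) :=
    SimpleGraph.map_injective _
  have h : basesWith ⊥ A.spanningCoe (L.map (Function.Embedding.subtype (· ∈ S)).sym2Map) =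
      SimpleGraph.spanningCoe '' basesWith ⊥ A L := by
    have hsub : ∀ X : SimpleGraph S,
        ↑(L.map (Function.Embedding.subtype (· ∈ S)).sym2Map) ⊆ X.spanningCoe.edgeSet ↔
          ↑L ⊆ X.edgeSet := by
      intro X
      rw [Finset.coe_map, Set.image_subset_iff]
      exact forall₂_congr fun e _ => mem_edgeSet_spanningCoe
    ext Y
    simp only [basesWith, bases_spanningCoe, Set.mem_ofPred_eq, Set.mem_image]
    constructor
    · rintro ⟨⟨X, hX, rfl⟩, hL⟩
      exact ⟨X, ⟨hX, (hsub X).1 hL⟩, rfl⟩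
    · rintro ⟨X, ⟨hX, hL⟩, rfl⟩
      exact ⟨⟨X, hX, rfl⟩, (hsub X).2 hL⟩
  rw [basesProb, basesProb, h, bases_spanningCoe, Set.ncard_image_of_injective _ hinj,
    Set.ncard_image_of_injective _ hinj]

section Components

variable {H : SimpleGraph V}

lemma iSup_spanningCoe_adj {T : ∀ C : H.ConnectedComponent, SimpleGraph C} {a b : V} :
    (⨆ C, (T C).spanningCoe).Adj a b ↔ ∃ C, ∃ (ha : a ∈ C) (hb : b ∈ C),
      (T C).Adj ⟨a, ha⟩ ⟨b, hb⟩ := by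
  rw [SimpleGraph.iSup_adj]
  refine exists_congr fun C => ?_
  rw [SimpleGraph.map_adj]
  constructor
  · rintro ⟨x, y, h, rfl, rfl⟩
    exact ⟨x.2, y.2, h⟩
  · rintro ⟨ha, hb, h⟩
    exact ⟨⟨a, ha⟩, ⟨b, hb⟩, h, rfl, rfl⟩

lemma component_eq {C C' : H.ConnectedComponent} {a : V} (h : a ∈ C) (h' : a ∈ C') : C = C' :=
  (SimpleGraph.ConnectedComponent.mem_supp_iff _ _).1 h ▸
    (SimpleGraph.ConnectedComponent.mem_supp_iff _ _).1 h'

lemma iSup_spanningCoe_closed {T : ∀ C : H.ConnectedComponent, SimpleGraph C}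
    (C : H.ConnectedComponent) (a b : V) (hab : (⨆ C, (T C).spanningCoe).Adj a b)
    (ha : a ∈ C.supp) : b ∈ C.supp := by
  obtain ⟨C', ha', hb', -⟩ := iSup_spanningCoe_adj.1 hab
  rw [component_eq (C' := C') ha ha']
  exact hb'

lemma induce_iSup_spanningCoe (T : ∀ C : H.ConnectedComponent, SimpleGraph C)
    (C : H.ConnectedComponent) : (⨆ C, (T C).spanningCoe).induce C.supp = T C := by
  ext ⟨a, ha⟩ ⟨b, hb⟩
  rw [SimpleGraph.comap_adj]
  constructor
  · intro h
    obtain ⟨C', ha', hb', h⟩ := iSup_spanningCoe_adj.1 h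
    obtain rfl := component_eq (C := C) (C' := C') ha ha'
    exact h
  · exact fun h => iSup_spanningCoe_adj.2 ⟨C, ha, hb, h⟩

lemma ae_infinitePi_of_ae_fsf [Countable H.ConnectedComponent]
    {p : ∀ C : H.ConnectedComponent, SimpleGraph C → Prop}
    (h : ∀ C, ∀ᵐ T ∂(fsf C.toSimpleGraph), p C T) :
    ∀ᵐ T ∂(Measure.infinitePi fun C : H.ConnectedComponent => fsf C.toSimpleGraph),
      ∀ C, p C (T C) := by
  refine ae_all_iff.2 fun C => ?_
  have := h C
  rw [← Measure.infinitePi_map_eval (fun C : H.ConnectedComponent => fsf C.toSimpleGraph) C] at this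
  exact ae_of_ae_map (measurable_pi_apply C).aemeasurable this

variable [Countable V]

instance : Countable H.ConnectedComponent := Quot.mk_surjective.countable

lemma measurable_iSup_spanningCoe :
    Measurable fun T : ∀ C : H.ConnectedComponent, SimpleGraph C => ⨆ C, (T C).spanningCoe := by
  refine SimpleGraph.measurable_iff_adj.2 fun u v => ?_
  simp only [iSup_spanningCoe_adj]
  refine Measurable.exists fun C => Measurable.exists fun hu => Measurable.exists fun hv => ?_
  exact (measurableSet_setOfPred.1
    (measurableSet_mem_edgeSet s((⟨u, hu⟩ : C), (⟨v, hv⟩ : C)))).comp (measurable_pi_apply C)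

instance : IsProbabilityMeasure (fsfOnComponents H) :=
  Measure.isProbabilityMeasure_map measurable_iSup_spanningCoe.aemeasurable

lemma measurableSet_isAcyclic : MeasurableSet {T : SimpleGraph V | T.IsAcyclic} := by
  have h : {T : SimpleGraph V | T.IsAcyclic} =
      ⋂ s ∈ {s : Finset (Sym2 V) | ¬ (SimpleGraph.fromEdgeSet (s : Set (Sym2 V))).IsAcyclic},
        (containing s)ᶜ := by
    ext T
    simp only [Set.mem_iInter]
    refine ⟨fun hT s hs hsT => hs (hT.anti (fromEdgeSet_le hsT)), fun h v c hc => ?_⟩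
    classical
    refine h c.edges.toFinset ?_ fun e he => c.edges_subset_edgeSet (by simpa using he)
    intro hac
    refine hac (c.transfer _ fun e he => ?_) (hc.transfer _)
    rw [SimpleGraph.edgeSet_fromEdgeSet]
    exact ⟨by simpa using he, SimpleGraph.not_isDiag_of_mem_edgeSet _ (c.edges_subset_edgeSet he)⟩
  rw [h]
  exact MeasurableSet.biInter (Set.to_countable _) fun s _ => (measurableSet_containing s).compl

lemma measurableSet_le (G : SimpleGraph V) : MeasurableSet {T : SimpleGraph V | T ≤ G} := by
  have h : {T : SimpleGraph V | T ≤ G} = ⋂ e ∈ (G.edgeSet)ᶜ, {T : SimpleGraph V | e ∈ T.edgeSet}ᶜ := by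
    ext T
    simp only [Set.mem_ofPred_eq, ← SimpleGraph.edgeSet_subset_edgeSet, Set.mem_iInter,
      Set.mem_compl_iff]
    exact ⟨fun h e he he' => he (h he'), fun h e he => by_contra fun hc => h e hc he⟩
  rw [h]
  exact MeasurableSet.biInter (Set.to_countable _) fun e _ => (measurableSet_mem_edgeSet e).compl

lemma fsfOnComponents_ae_le (H : SimpleGraph V) : ∀ᵐ T ∂(fsfOnComponents H), T ≤ H := by
  rw [fsfOnComponents, ae_map_iff measurable_iSup_spanningCoe.aemeasurable (measurableSet_le H)]
  filter_upwards [ae_infinitePi_of_ae_fsf fun C => (isFSF_fsf C.toSimpleGraph).ae_le] with T hT a b hab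
  obtain ⟨C, ha, hb, h⟩ := iSup_spanningCoe_adj.1 hab
  exact hT C h

lemma fsfOnComponents_ae_isAcyclic (H : SimpleGraph V) :
    ∀ᵐ T ∂(fsfOnComponents H), T.IsAcyclic := by
  rw [fsfOnComponents, ae_map_iff measurable_iSup_spanningCoe.aemeasurable measurableSet_isAcyclic]
  filter_upwards [ae_infinitePi_of_ae_fsf fun C =>
    (isFSF_fsf C.toSimpleGraph).ae_isAcyclic C.connected_toSimpleGraph] with T hT
  refine isAcyclic_of_induce fun a b hab => ?_
  obtain ⟨C, ha, -, -⟩ := iSup_spanningCoe_adj.1 hab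
  refine ⟨C.supp, ha, iSup_spanningCoe_closed C, ?_⟩
  rw [induce_iSup_spanningCoe]
  exact hT C

open Classical in
-- Negative association bounds the joint inclusion probability by a product over finite graphs in
-- the separate components. These exhaust the components, and the limiting product is the inclusion
-- probability for independent forests.
lemma windowProb_le_fsfOnComponents {Q : ℕ → SimpleGraph V} (hQ : IsWindow Q) (H : SimpleGraph V)
    (L : Finset (Sym2 V)) : windowProb Q L H ≤ fsfOnComponents H (containing L) := by
  by_cases hL : ↑L ⊆ H.edgeSet
  swap
  · have h : ∀ n, basesProb ⊥ (H ⊓ Q n) L = 0 := fun n =>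
      basesProb_eq_zero (basesWith_eq_empty_of_not_subset fun h =>
        hL (h.trans (SimpleGraph.edgeSet_mono inf_le_left)))
    simp [windowProb, h]
  -- The components met by `L`, each found from an arbitrarily chosen endpoint of an edge.
  let I : Finset H.ConnectedComponent := L.image fun e => H.connectedComponentMk e.out.1
  let i : ∀ C : H.ConnectedComponent, C ↪ V := fun C => Function.Embedding.subtype _
  let S : ∀ C : H.ConnectedComponent, Finset (Sym2 C) := fun C =>
    L.preimage (i C).sym2Map (i C).sym2Map.injective.injOn
  have hLI : L = I.biUnion fun C => (S C).map (i C).sym2Map := by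
    ext e
    simp only [Finset.mem_biUnion, Finset.mem_map, S, Finset.mem_preimage]
    refine ⟨fun he => ⟨_, Finset.mem_image_of_mem _ he, ?_⟩, ?_⟩
    · set C := H.connectedComponentMk e.out.1
      have h1 : e.out.1 ∈ C := SimpleGraph.ConnectedComponent.connectedComponentMk_mem
      have hout : s(e.out.1, e.out.2) = e := e.out_eq
      have hadj : H.Adj e.out.1 e.out.2 := by
        have := hL he
        rwa [← hout, SimpleGraph.mem_edgeSet] at this
      have h2 : e.out.2 ∈ C := C.mem_supp_of_adj_mem_supp h1 hadj
      have h3 : (i C).sym2Map s(⟨e.out.1, h1⟩, ⟨e.out.2, h2⟩) = e := hout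
      exact ⟨s(⟨e.out.1, h1⟩, ⟨e.out.2, h2⟩), by rw [h3]; exact he, h3⟩
    · rintro ⟨C, -, e', he', rfl⟩
      exact he'
  have hSC : ∀ C : H.ConnectedComponent, (S C : Set (Sym2 C)) ⊆ C.toSimpleGraph.edgeSet := by
    intro C e he
    have h := hL (Finset.mem_preimage.1 he)
    induction e with
    | _ a b => exact h
  have hprod : ∏ C ∈ I, fsf C.toSimpleGraph (containing (S C)) ≤
      fsfOnComponents H (containing L) := by
    rw [fsfOnComponents, Measure.map_apply measurable_iSup_spanningCoe (measurableSet_containing L),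
      ← Measure.infinitePi_pi (fun C : H.ConnectedComponent => fsf C.toSimpleGraph)
        fun C _ => measurableSet_containing (S C)]
    refine measure_mono fun T hT e he => ?_
    rw [hLI] at he
    simp only [Finset.coe_biUnion, Set.mem_iUnion, Finset.coe_map] at he
    obtain ⟨C, hC, e', he', rfl⟩ := he
    have h : e' ∈ (T C).edgeSet := hT C hC he'
    have hle : (T C).spanningCoe ≤ ⨆ C, (T C).spanningCoe := le_iSup (fun C => (T C).spanningCoe) C
    exact SimpleGraph.edgeSet_mono hle (mem_edgeSet_spanningCoe.2 h)
  refine le_trans ?_ hprod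
  choose K hK _ using fun C : H.ConnectedComponent =>
    exists_isExhaustion C.connected_toSimpleGraph
  have hlim : Tendsto (fun m => ∏ C ∈ I, basesProb ⊥ (K C m).spanningCoe (S C)) atTop
      (𝓝 (∏ C ∈ I, fsf C.toSimpleGraph (containing (S C)))) :=
    ENNReal.tendsto_finsetProd_of_ne_top _
      (fun C _ => (isFSF_fsf C.toSimpleGraph).tendsto_containing (hK C) (hSC C))
      fun C _ => measure_ne_top _ _
  -- The stage `m` of the exhaustions is fixed first. The window `Q n` eventually contains the
  -- finitely many graphs `B C`, which bounds the limsup in `n`; only then does `m` tend to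
  -- infinity.
  refine ge_of_tendsto hlim ?_
  have hev : ∀ᶠ m in atTop, ∀ C ∈ I, (S C : Set (Sym2 C)) ⊆ (K C m).spanningCoe.edgeSet := by
    refine (Filter.eventually_all_finset I).2 fun C _ => ?_
    have hle : SimpleGraph.fromEdgeSet (S C : Set (Sym2 C)) ≤ C.toSimpleGraph := fromEdgeSet_le (hSC C)
    filter_upwards [(hK C).eventually_le (finite_fromEdgeSet (S C)) hle] with m hm
    refine subset_trans (fun e he => ?_) (SimpleGraph.edgeSet_mono hm)
    rw [SimpleGraph.edgeSet_fromEdgeSet]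
    exact ⟨he, SimpleGraph.not_isDiag_of_mem_edgeSet _ (hSC C he)⟩
  filter_upwards [hev] with m hm
  let B : H.ConnectedComponent → SimpleGraph V := fun C =>
    SimpleGraph.spanningCoe (s := C.supp) (K C m).spanningCoe
  have hBH : ∀ C, B C ≤ H := by
    intro C a b hab
    rw [SimpleGraph.map_adj] at hab
    obtain ⟨x, y, h, rfl, rfl⟩ := hab
    exact (K C m).spanningCoe_le h
  have hBf : ∀ C, (B C).edgeSet.Finite := fun C => by
    have := ((hK C).finite_edgeSet m).image (Sym2.map (i C))
    refine this.subset fun e he => ?_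
    induction e with
    | _ a b =>
    have he' : (B C).Adj a b := he
    rw [SimpleGraph.map_adj] at he'
    obtain ⟨x, y, h, rfl, rfl⟩ := he'
    exact ⟨s(x, y), h, rfl⟩
  refine limsup_le_of_le (h := ?_)
  have hevQ : ∀ᶠ n in atTop, ∀ C ∈ I, B C ≤ Q n :=
    (Filter.eventually_all_finset I).2 fun C _ => hQ.eventually_le _ (hBf C)
  filter_upwards [hevQ] with n hn
  conv_lhs => rw [hLI]
  refine (basesProb_biUnion_le_prod (finite_edgeSet_of_le (hQ.finite n) inf_le_right) I B
    (fun C hC => le_inf (hBH C) (hn C hC)) (fun C => (S C).map (i C).sym2Map) ?_ ?_).trans ?_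
  · intro C hC e he
    rw [Finset.coe_map] at he
    obtain ⟨e', he', rfl⟩ := he
    exact mem_edgeSet_spanningCoe.2 (hm C hC he')
  · intro C _ C' _ hne
    rw [Function.onFun, Finset.disjoint_left]
    intro e he he'
    obtain ⟨e₁, -, rfl⟩ := Finset.mem_map.1 he
    obtain ⟨e₂, -, h⟩ := Finset.mem_map.1 he'
    induction e₁ with
    | _ a b =>
    have ha : a.1 ∈ (i C').sym2Map e₂ := by
      rw [h]
      exact Sym2.mem_mk_left _ _
    obtain ⟨c, -, hc⟩ := Sym2.mem_map.1 ha
    exact hne (component_eq (a := a.1) a.2 (hc ▸ c.2))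
  · exact Finset.prod_le_prod' fun C _ => (basesProb_spanningCoe (K C m).spanningCoe (S C)).le

/-- The union of the forests has no edges between components, so a path of it joining two vertices
of `C` uses only the forest on `C`. -/
lemma fsf_ae_connected (hH : ∀ᵐ T ∂(fsfOnComponents H), H.Adj ≤ T.Reachable)
    (C : H.ConnectedComponent) : ∀ᵐ T ∂(fsf C.toSimpleGraph), T.Connected := by
  have hne : Nonempty C := C.connected_toSimpleGraph.nonempty
  have hmeas : MeasurableSet {T : SimpleGraph C | T.Connected} := by
    have : {T : SimpleGraph C | T.Connected} = ⋂ a : C, ⋂ b : C, {T | T.Reachable a b} := by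
      ext T
      simp only [Set.mem_ofPred_eq, Set.mem_iInter]
      exact ⟨fun h => h.preconnected, fun h => SimpleGraph.Connected.mk h⟩
    rw [this]
    exact MeasurableSet.iInter fun a => MeasurableSet.iInter fun b => measurableSet_reachable a b
  rw [← Measure.infinitePi_map_eval (fun C : H.ConnectedComponent => fsf C.toSimpleGraph) C]
  refine (ae_map_iff (measurable_pi_apply C).aemeasurable hmeas).2 ?_
  have h := ae_of_ae_map measurable_iSup_spanningCoe.aemeasurable hH
  filter_upwards [h] with T hT
  refine SimpleGraph.Connected.mk fun a b => ?_
  have h1 : H.Reachable a.1 b.1 := C.reachable_of_mem_supp a.2 b.2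
  obtain ⟨_, h2⟩ := reachable_induce (iSup_spanningCoe_closed (T := T) C) a.2
    (reachable_of_adj_le hT h1)
  rwa [induce_iSup_spanningCoe] at h2

end Components

/-! ### Countability of the vertex set and the conclusion -/

lemma countable_of_connected {G : SimpleGraph V} [G.LocallyFinite] (hG : G.Connected) :
    Countable V := by
  obtain ⟨v⟩ := hG.nonempty
  have hfin : ∀ n : ℕ, {w | ∃ p : G.Walk v w, p.length = n}.Finite := by
    intro n
    induction n with
    | zero =>
      refine (Set.finite_singleton v).subset ?_
      rintro w ⟨p, hp⟩
      exact (SimpleGraph.Walk.eq_of_length_eq_zero hp).symm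
    | succ n ih =>
      refine (ih.biUnion fun w _ => Set.toFinite (G.neighborSet w)).subset ?_
      rintro w ⟨p, hp⟩
      have hnil : ¬ p.Nil := by
        rw [← SimpleGraph.Walk.length_eq_zero_iff]
        omega
      exact Set.mem_biUnion (x := p.penultimate) ⟨p.dropLast, by simp [hp]⟩
        (p.adj_penultimate hnil)
  have h : (⋃ n : ℕ, {w | ∃ p : G.Walk v w, p.length = n}).Countable :=
    Set.countable_iUnion fun n => (hfin n).countable
  refine Set.countable_univ_iff.1 (h.mono fun w _ => ?_)
  obtain ⟨p⟩ := hG.preconnected v w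
  exact Set.mem_iUnion.2 ⟨p.length, p, rfl⟩

lemma IsBasesLimit.fsfOfRandom_eq [Countable V] {G : SimpleGraph V} {μ : Measure (SimpleGraph V)}
    (hμ : IsBasesLimit G μ) :
    fsfOfRandom (μ.map (inducedComponentGraph G)) = μ ∧
    ∀ᵐ F ∂μ, ∀ C : (inducedComponentGraph G F).ConnectedComponent,
      IsFSF C.toSimpleGraph (fsf C.toSimpleGraph) ∧ ∀ᵐ T ∂(fsf C.toSimpleGraph), T.Connected := by
  obtain ⟨Q, hQ⟩ := exists_isWindow V
  obtain ⟨h1, h2⟩ := hμ.resample hQ fsfOnComponents fsfOnComponents_ae_le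
    fsfOnComponents_ae_isAcyclic (windowProb_le_fsfOnComponents hQ)
  refine ⟨h1, ?_⟩
  filter_upwards [ae_of_ae_map (measurable_inducedComponentGraph G).aemeasurable h2] with F hF C
  exact ⟨isFSF_fsf _, fsf_ae_connected hF C⟩

end SpanningForest

theorem theorem1p4 {V : Type*} [Infinite V] (G : SimpleGraph V) [G.LocallyFinite]
    (hG : G.Connected) :
    SpanningForest.IsWSF G (SpanningForest.wsf G) ∧
    SpanningForest.IsFSF G (SpanningForest.fsf G) ∧
    SpanningForest.fsfOfRandom
        ((SpanningForest.wsf G).map (SpanningForest.inducedComponentGraph G)) =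
      SpanningForest.wsf G ∧
    SpanningForest.fsfOfRandom
        ((SpanningForest.fsf G).map (SpanningForest.inducedComponentGraph G)) =
      SpanningForest.fsf G ∧
    (∀ᵐ F ∂(SpanningForest.wsf G),
      ∀ C : (SpanningForest.inducedComponentGraph G F).ConnectedComponent,
        SpanningForest.IsFSF C.toSimpleGraph (SpanningForest.fsf C.toSimpleGraph) ∧
        ∀ᵐ T ∂(SpanningForest.fsf C.toSimpleGraph), T.Connected) ∧
    (∀ᵐ F ∂(SpanningForest.fsf G),
      ∀ C : (SpanningForest.inducedComponentGraph G F).ConnectedComponent,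
        SpanningForest.IsFSF C.toSimpleGraph (SpanningForest.fsf C.toSimpleGraph) ∧
        ∀ᵐ T ∂(SpanningForest.fsf C.toSimpleGraph), T.Connected) := by
  have := SpanningForest.countable_of_connected hG
  have hw := SpanningForest.isWSF_wsf hG
  have hf := SpanningForest.isFSF_fsf G
  obtain ⟨hw1, hw2⟩ := (hw.isBasesLimit hG).fsfOfRandom_eq
  obtain ⟨hf1, hf2⟩ := (hf.isBasesLimit hG).fsfOfRandom_eq
  exact ⟨hw, hf, hw1, hf1, hw2, hf2⟩
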